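/- Let $n\ge 1$, $T>0$, and let $A:\mathbb R\to\mathbb R^{n\times n}$ be a measurable, locally essentially bounded matrix function with $A(t+T)=A(t)$ for all $t$. Let $\Phi(t,t_0)$ be its transition matrix, i.e. the locally absolutely continuous solution of $\frac{d}{dt}\Phi(t,t_0)=A(t)\Phi(t,t_0)$ (for almost all $t$), $\Phi(t_0,t_0)=I$. Assume that the system is a totally positive differential system (TPDS) on $(0,T)$: for all $0<t_0<t<T$ every minor (of every order) of $\Phi(t,t_0)$ is positive. Let $\mathcal V\subset\mathbb R^n$ be the set of vectors $y$ with $y_1\neq0$, $y_n\ne 0$, and $y_{l-1}y_{l+1}<0$ whenever $1<l<n$ and $y_l=0$. For $y$ with no zero entries let $\sigma(y)=|\{l\in\{1,\dots,n-1\}: y_ly_{l+1}<0\}|$, and extend $\sigma$ to $\mathcal V$ by continuity. Then the eigenvalues of the monodromy matrix $\Phi(T,0)$ are real, positive and simple, $\alpha_1>\alpha_2>\dots>\alpha_n>0$. Let $p^1,\dots,p^n\in\mathbb R^n$ be any corresponding eigenvectors, let $1\le i\le j\le n$, let $c_i,\dots,c_j\in\mathbb R$ with $c_i\ne0$, and let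 $z$ be the solution on $[0,\infty)$ of $\dot z=A(t)z$, $z(0)=\sum_{k=i}^j c_kp^k$. Then: 1. for all $t\ge0$ except at most $j-i$ points, $z(t)\in\mathcal V$ and $i-1\le\sigma(z(t))\le j-1$; 2. for all sufficiently large $t$, $z(t)\in\mathcal V$ and $\sigma(z(t))=i-1$; 3. if $z(0)=c_ip^i$, then $z(t)\in\mathcal V$ and $\sigma(z(t))=i-1$ for all $t\ge0$. -/

import Mathlib

open MeasureTheory Set Filter Topology
open scoped Matrix

/-- A real square matrix is *totally positive* if the determinant of every square submatrix
(rows `r` and columns `c` chosen in increasing order) is positive. -/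
def IsTotallyPositive {n : ℕ} (M : Matrix (Fin n) (Fin n) ℝ) : Prop :=
  ∀ (k : ℕ) (r c : Fin k → Fin n), StrictMono r → StrictMono c → 0 < (M.submatrix r c).det

/-- The number of indices at which adjacent entries of `y` have opposite signs. -/
noncomputable def adjacentSignChanges {n : ℕ} (y : Fin n → ℝ) : ℕ :=
  {q : Fin n × Fin n | (q.1 : ℕ) + 1 = q.2 ∧ y q.1 * y q.2 < 0}.ncard

/-- The set `𝒱` of vectors whose first and last entries are nonzero and whose
other zero entries lie between two neighbours of opposite signs. -/
def signSet (n : ℕ) : Set (Fin n → ℝ) :=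
  {y | (∀ k : Fin n, (k : ℕ) = 0 ∨ (k : ℕ) + 1 = n → y k ≠ 0) ∧
    ∀ k l m : Fin n, (k : ℕ) + 1 = l → (l : ℕ) + 1 = m → y l = 0 → y k * y m < 0}

/-- The number `σ(y)` of sign variations: `adjacentSignChanges` on vectors without zero entries,
extended by continuity. It is meaningful on `signSet n`. -/
noncomputable def signVariations {n : ℕ} (y : Fin n → ℝ) : ℕ :=
  extendFrom {x : Fin n → ℝ | ∀ k, x k ≠ 0} adjacentSignChanges y

/-- `A` is a matrix of (Lebesgue) measurable, locally essentially bounded functions on `ℝ`. -/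
def IsLocallyEssBoundedMeasurable {n : ℕ} (A : ℝ → Matrix (Fin n) (Fin n) ℝ) : Prop :=
  (∀ i j, AEMeasurable (fun t => A t i j) volume) ∧
    ∀ a b : ℝ, ∃ C : ℝ, ∀ᵐ t, t ∈ Icc a b → ∀ i j, |A t i j| ≤ C

/-- `z` solves `ż = A(t) z` on the interval `I` in the sense of Carathéodory: it is locally
absolutely continuous on `I` and satisfies the equation at almost every `t ∈ I`. -/
def IsSolutionOn {n : ℕ} (A : ℝ → Matrix (Fin n) (Fin n) ℝ) (I : Set ℝ)
    (z : ℝ → Fin n → ℝ) : Prop :=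
  (∀ a b : ℝ, uIcc a b ⊆ I → AbsolutelyContinuousOnInterval z a b) ∧
    ∀ᵐ t, t ∈ I → HasDerivAt z (A t *ᵥ z t) t

/-- `Φ t t₀` is the transition matrix of `ż = A(t) z`:
`d/dt Φ(t, t₀) = A(t) Φ(t, t₀)` (column by column) and `Φ(t₀, t₀) = I`. -/
def IsTransitionMatrix {n : ℕ} (A : ℝ → Matrix (Fin n) (Fin n) ℝ)
    (Φ : ℝ → ℝ → Matrix (Fin n) (Fin n) ℝ) : Prop :=
  ∀ t₀ : ℝ, Φ t₀ t₀ = 1 ∧ ∀ k : Fin n, IsSolutionOn A univ (fun t => (Φ t t₀).col k)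

/-- The system with transition matrix `Φ` is a totally positive differential system on `(a, b)`. -/
def IsTPDS {n : ℕ} (Φ : ℝ → ℝ → Matrix (Fin n) (Fin n) ℝ) (a b : ℝ) : Prop :=
  ∀ t₀ t : ℝ, a < t₀ → t₀ < t → t < b → IsTotallyPositive (Φ t t₀)

/-! The engine is a strong form of variation diminution: for totally positive `M` and `x ≠ 0`, a
weakly alternating subsequence of `M x` forces a strictly alternating subsequence of `x` of the same
length and leading sign (`IsTotallyPositive.variationDiminishing`). Total positivity enters only
through this property, which is stable under products. Limits at the ends of the period, together
with periodicity, give it to `Φ t s` for all `0 ≤ s < t` (`IsTPDS.variationDiminishing`).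

Call a vector sign definite if its weak alternations are all attained strictly. Such a vector lies
in `signSet n`, and its `σ` is its maximal number of strict alternations
(`SignDefinite.mem_signSet`, `SignDefinite.signVariations_eq`). Eigenvectors of the monodromy matrix
are sign definite, so their first entry is nonzero. A second independent eigenvector for the same
eigenvalue is impossible, since some combination would have first entry zero. A nonreal eigenvalue
is excluded in the same way, using recurrence of rotations (`complex_eigenvalue_im`). A Jordan block
is excluded because forward and backward iterates approach opposite directions (`no_jordan`).

For a combination of eigenvectors, forward iteration isolates the lowest index present and backward
iteration the highest. Strict alternations of the forward limit pull back to the combination, and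
weak ones of the combination pass to the backward limit. This identifies the sign changes of each
eigenvector and bounds those of `z`. Along the flow the strict count never increases. At a time when
`z` is not sign definite the weak count exceeds the strict one, so the count has just dropped; it
stays between `i` and `j`, hence at most `j - i` such times exist (`exists_finset_sign_changes`). -/

/-! ### Weakly and strictly alternating subsequences. -/

section Alternation

variable {n : ℕ}

/-- `y` has a subsequence of length `k + 1` with weakly alternating signs, the first of which is
that of `ε`. -/
def WeakAlt (ε : ℝ) (y : Fin n → ℝ) (k : ℕ) : Prop :=
  ∃ r : Fin (k + 1) → Fin n, StrictMono r ∧ ∀ i : Fin (k + 1), 0 ≤ ε * (-1) ^ (i : ℕ) * y (r i)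

/-- `y` has a subsequence of length `k + 1` with strictly alternating signs, the first of which is
that of `ε`. -/
def StrongAlt (ε : ℝ) (y : Fin n → ℝ) (k : ℕ) : Prop :=
  ∃ r : Fin (k + 1) → Fin n, StrictMono r ∧ ∀ i : Fin (k + 1), 0 < ε * (-1) ^ (i : ℕ) * y (r i)

lemma StrongAlt.weakAlt {ε : ℝ} {y : Fin n → ℝ} {k : ℕ} (h : StrongAlt ε y k) :
    WeakAlt ε y k := by
  obtain ⟨r, hr, h⟩ := h
  exact ⟨r, hr, fun i => (h i).le⟩

lemma StrongAlt.ne_zero {ε : ℝ} {y : Fin n → ℝ} {k : ℕ} (h : StrongAlt ε y k) : ε ≠ 0 := by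
  obtain ⟨r, hr, h⟩ := h
  rintro rfl
  simpa using h 0

lemma StrongAlt.vec_ne_zero {ε : ℝ} {y : Fin n → ℝ} {k : ℕ} (h : StrongAlt ε y k) : y ≠ 0 := by
  obtain ⟨r, hr, h⟩ := h
  rintro rfl
  simpa using h 0

lemma WeakAlt.lt {ε : ℝ} {y : Fin n → ℝ} {k : ℕ} (h : WeakAlt ε y k) : k < n := by
  obtain ⟨r, hr, -⟩ := h
  simpa using Fintype.card_le_of_injective r hr.injective

lemma WeakAlt.init {ε : ℝ} {y : Fin n → ℝ} {k : ℕ} (h : WeakAlt ε y (k + 1)) :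
    WeakAlt ε y k := by
  obtain ⟨r, hr, h⟩ := h
  exact ⟨fun i : Fin (k + 1) => r i.castSucc, hr.comp Fin.strictMono_castSucc, fun i => by
    simpa using h i.castSucc⟩

lemma StrongAlt.init {ε : ℝ} {y : Fin n → ℝ} {k : ℕ} (h : StrongAlt ε y (k + 1)) :
    StrongAlt ε y k := by
  obtain ⟨r, hr, h⟩ := h
  exact ⟨fun i : Fin (k + 1) => r i.castSucc, hr.comp Fin.strictMono_castSucc, fun i => by
    simpa using h i.castSucc⟩

lemma WeakAlt.tail {ε : ℝ} {y : Fin n → ℝ} {k : ℕ} (h : WeakAlt ε y (k + 1)) :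
    WeakAlt (-ε) y k := by
  obtain ⟨r, hr, h⟩ := h
  exact ⟨fun i : Fin (k + 1) => r i.succ, hr.comp Fin.strictMono_succ, fun i => by
    simpa [pow_succ] using h i.succ⟩

lemma StrongAlt.tail {ε : ℝ} {y : Fin n → ℝ} {k : ℕ} (h : StrongAlt ε y (k + 1)) :
    StrongAlt (-ε) y k := by
  obtain ⟨r, hr, h⟩ := h
  exact ⟨fun i : Fin (k + 1) => r i.succ, hr.comp Fin.strictMono_succ, fun i => by
    simpa [pow_succ] using h i.succ⟩

lemma WeakAlt.mono {ε : ℝ} {y : Fin n → ℝ} {k l : ℕ} (h : WeakAlt ε y l) (hkl : k ≤ l) :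
    WeakAlt ε y k := by
  induction l, hkl using Nat.le_induction with
  | base => exact h
  | succ l _ ih => exact ih h.init

lemma StrongAlt.mono {ε : ℝ} {y : Fin n → ℝ} {k l : ℕ} (h : StrongAlt ε y l) (hkl : k ≤ l) :
    StrongAlt ε y k := by
  induction l, hkl using Nat.le_induction with
  | base => exact h
  | succ l _ ih => exact ih h.init

lemma WeakAlt.of_smul {ε c : ℝ} {y : Fin n → ℝ} {k : ℕ} (h : WeakAlt ε (c • y) k) :
    WeakAlt (ε * c) y k := by
  obtain ⟨r, hr, h⟩ := h
  exact ⟨r, hr, fun i => by have := h i; simp only [Pi.smul_apply, smul_eq_mul] at this; linarith⟩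

lemma StrongAlt.of_smul {ε c : ℝ} {y : Fin n → ℝ} {k : ℕ} (h : StrongAlt ε (c • y) k) :
    StrongAlt (ε * c) y k := by
  obtain ⟨r, hr, h⟩ := h
  exact ⟨r, hr, fun i => by have := h i; simp only [Pi.smul_apply, smul_eq_mul] at this; linarith⟩

lemma WeakAlt.sign_congr {ε δ : ℝ} {y : Fin n → ℝ} {k : ℕ} (h : WeakAlt ε y k)
    (hεδ : 0 < ε * δ) : WeakAlt δ y k := by
  obtain ⟨r, hr, h⟩ := h
  refine ⟨r, hr, fun i : Fin (k + 1) => ?_⟩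
  have h1 : 0 ≤ (ε * δ) * (ε * (-1) ^ (i : ℕ) * y (r i)) := mul_nonneg hεδ.le (h i)
  have h2 : 0 < ε ^ 2 := by
    have : ε ≠ 0 := by rintro rfl; simp at hεδ
    positivity
  refine nonneg_of_mul_nonneg_right (a := ε ^ 2) ?_ h2
  nlinarith

lemma StrongAlt.sign_congr {ε δ : ℝ} {y : Fin n → ℝ} {k : ℕ} (h : StrongAlt ε y k)
    (hεδ : 0 < ε * δ) : StrongAlt δ y k := by
  obtain ⟨r, hr, h⟩ := h
  refine ⟨r, hr, fun i : Fin (k + 1) => ?_⟩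
  have h1 : 0 < (ε * δ) * (ε * (-1) ^ (i : ℕ) * y (r i)) := mul_pos hεδ (h i)
  refine pos_of_mul_pos_right (a := ε ^ 2) ?_ (sq_nonneg _)
  nlinarith

/-- With a term to spare, either leading sign is available: keep the first term or drop it. -/
lemma StrongAlt.of_lt {ε δ : ℝ} {y : Fin n → ℝ} {k l : ℕ} (h : StrongAlt ε y l)
    (hkl : k < l) (hδ : δ ≠ 0) : StrongAlt δ y k := by
  rcases lt_or_gt_of_ne (mul_ne_zero h.ne_zero hδ) with h0 | h0
  · exact (h.mono (Nat.succ_le_of_lt hkl)).tail.sign_congr (by linarith)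
  · exact (h.mono hkl.le).sign_congr h0

lemma WeakAlt.zero_of_nonneg {δ : ℝ} (y : Fin n → ℝ) (a : Fin n) (h : 0 ≤ δ * y a) :
    WeakAlt δ y 0 :=
  ⟨fun _ => a, fun i j hij => absurd hij (by simp [Subsingleton.elim (α := Fin 1) i j]),
    fun i => by simpa [Subsingleton.elim (α := Fin 1) i 0] using h⟩

/-- A leading zero entry can be used to lengthen an alternating subsequence. -/
lemma StrongAlt.weakAlt_succ_of_first_eq_zero {ε : ℝ} {y : Fin (n + 1) → ℝ} {k : ℕ}
    (h : StrongAlt ε y k) (h0 : y 0 = 0) : WeakAlt (-ε) y (k + 1) := by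
  obtain ⟨r, hr, h⟩ := h
  refine ⟨Fin.cons 0 r, ?_, fun i : Fin (k + 2) => ?_⟩
  · have : r 0 ≠ 0 := fun hh => by simpa [hh, h0] using h 0
    rw [Fin.strictMono_iff_lt_succ]
    intro i
    cases i using Fin.cases with
    | zero => simpa using Fin.pos_of_ne_zero this
    | succ i =>
      rw [← Fin.succ_castSucc, Fin.cons_succ, Fin.cons_succ]
      exact hr (Fin.castSucc_lt_succ)
  · cases i using Fin.cases with
    | zero => simp [h0]
    | succ i =>
      have := h i
      simp only [Fin.cons_succ, Fin.val_succ, pow_succ]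
      linarith

end Alternation

/-! ### Adjacent sign changes and blocks of constant sign. -/

lemma adjacentSignChanges_succ {n : ℕ} (x : Fin (n + 2) → ℝ) :
    adjacentSignChanges x =
      adjacentSignChanges (fun i : Fin (n + 1) => x i.succ) + if x 0 * x 1 < 0 then 1 else 0 := by
  unfold adjacentSignChanges
  set S' := {q : Fin (n + 1) × Fin (n + 1) | (q.1 : ℕ) + 1 = q.2 ∧ x q.1.succ * x q.2.succ < 0}
  have hinj : Function.Injective (Prod.map Fin.succ Fin.succ : Fin (n + 1) × Fin (n + 1) → _) :=
    (Fin.succ_injective _).prodMap (Fin.succ_injective _)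
  have hS : {q : Fin (n + 2) × Fin (n + 2) | (q.1 : ℕ) + 1 = q.2 ∧ x q.1 * x q.2 < 0} =
      Prod.map Fin.succ Fin.succ '' S' ∪ {q | q = (0, 1) ∧ x 0 * x 1 < 0} := by
    ext ⟨a, b⟩
    simp only [mem_ofPred_eq, mem_union, mem_image, Prod.exists, Prod.map_apply, Prod.mk.injEq, S']
    constructor
    · rintro ⟨h1, h2⟩
      cases a using Fin.cases with
      | zero =>
        have hb : b = 1 := Fin.ext (by simpa using h1.symm)
        subst hb
        exact Or.inr ⟨⟨rfl, rfl⟩, h2⟩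
      | succ a =>
        cases b using Fin.cases with
        | zero => simp at h1
        | succ b => exact Or.inl ⟨a, b, ⟨by simpa using h1, h2⟩, rfl, rfl⟩
    · rintro (⟨a', b', ⟨h1, h2⟩, rfl, rfl⟩ | ⟨⟨rfl, rfl⟩, h⟩)
      · exact ⟨by simpa using h1, h2⟩
      · exact ⟨by simp, h⟩
  rw [hS, ncard_union_eq, ncard_image_of_injective _ hinj]
  · congr 1
    split_ifs with h <;> simp [h]
  · rw [disjoint_left]
    rintro q ⟨⟨a, b⟩, -, rfl⟩ ⟨h, -⟩
    simp at h

lemma neg_one_pow_sq (k : ℕ) : ((-1 : ℝ) ^ k) * (-1) ^ k = 1 := by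
  rw [← mul_pow]; simp

/-- A nonzero vector splits into maximal blocks of consecutive entries on which its entries have
constant sign, with the sign alternating from one block to the next. -/
lemma exists_block : ∀ {n : ℕ} (x : Fin n → ℝ), x ≠ 0 →
    ∃ (p : ℕ) (ε : ℝ) (r : Fin (p + 1) → Fin n) (β : Fin n → Fin (p + 1)),
      StrictMono r ∧ Monotone β ∧ (∀ i, β (r i) = i) ∧
      (∀ i : Fin (p + 1), 0 < ε * (-1) ^ (i : ℕ) * x (r i)) ∧
      (∀ j, 0 ≤ ε * (-1) ^ (β j : ℕ) * x j) ∧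
      ((∀ j, x j ≠ 0) → adjacentSignChanges x = p)
  | 0, x, hx => absurd (Subsingleton.elim _ _) hx
  | n + 1, x, hx => by
    by_cases hx' : (fun i : Fin n => x i.succ) = 0
    · have hx0 : x 0 ≠ 0 := by
        intro h
        apply hx
        ext i
        cases i using Fin.cases with
        | zero => exact h
        | succ i => exact congrFun hx' i
      refine ⟨0, x 0, fun _ => 0, fun _ => 0, ?_, monotone_const, ?_, ?_, ?_, ?_⟩
      · intro i j hij
        exact absurd hij (by simp [Subsingleton.elim (α := Fin 1) i j])
      · intro i; exact Subsingleton.elim (α := Fin 1) _ _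
      · intro i
        have : (i : ℕ) = 0 := by have := i.2; omega
        rw [this]
        simpa using hx0
      · intro j
        cases j using Fin.cases with
        | zero => simpa using mul_self_nonneg (x 0)
        | succ j => have := congrFun hx' j; simp_all
      · intro hne
        cases n with
        | zero =>
          have : {q : Fin 1 × Fin 1 | (q.1 : ℕ) + 1 = q.2 ∧ x q.1 * x q.2 < 0} = ∅ := by
            ext ⟨a, b⟩
            simp only [mem_ofPred_eq, mem_empty_iff_false, iff_false, not_and]
            intro h
            have := b.2
            omega
          simp only [Nat.reduceAdd, adjacentSignChanges] at this ⊢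
          rw [this]; simp
        | succ m => exact absurd (congrFun hx' 0) (hne _)
    · obtain ⟨p, ε, r, β, hr, hβ, hβr, hpos, hnn, hadj⟩ := exists_block _ hx'
      have hβ0 : ∀ j : Fin n, (j : ℕ) = 0 → β j = 0 := fun j hj => by
        apply le_antisymm _ (Fin.zero_le _)
        rw [← hβr 0]
        exact hβ (Fin.le_def.2 (by omega))
      -- The new leading entry joins the first block unless its sign is strictly opposite; a zero
      -- always joins.
      by_cases h0 : 0 ≤ ε * x 0
      · refine ⟨p, ε, fun i => (r i).succ, Fin.cons 0 β, Fin.strictMono_succ.comp hr, ?_, ?_, hpos,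
          ?_, ?_⟩
        · rw [Fin.monotone_iff_le_succ]
          intro i
          cases n with
          | zero => exact i.elim0
          | succ m =>
            cases i using Fin.cases with
            | zero => simp
            | succ i =>
              rw [← Fin.succ_castSucc, Fin.cons_succ, Fin.cons_succ]
              exact hβ (Fin.castSucc_lt_succ).le
        · intro i; rw [Fin.cons_succ]; exact hβr i
        · intro j
          cases j using Fin.cases with
          | zero => simpa using h0
          | succ j => simpa using hnn j
        · intro hne
          cases n with
          | zero => exact (r 0).elim0
          | succ m =>
            rw [adjacentSignChanges_succ, hadj (fun j => hne _), if_neg]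
            · rfl
            have h1 := hnn 0
            rw [hβ0 0 rfl] at h1
            have h2 : 0 < ε * x 0 := lt_of_le_of_ne h0 fun h => by
              rcases mul_eq_zero.1 h.symm with h | h
              · simpa [h] using hpos 0
              · exact hne 0 h
            simp only [Fin.val_zero, pow_zero, mul_one] at h1
            intro h3
            change 0 ≤ ε * x 1 at h1
            have := mul_nonneg h2.le h1
            have h4 : 0 < ε ^ 2 := by
              have : ε ≠ 0 := by rintro rfl; simp at h2
              positivity
            nlinarith
      · push Not at h0
        refine ⟨p + 1, -ε, Fin.cons 0 (fun i => (r i).succ), Fin.cons 0 (fun i => (β i).succ), ?_,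
          ?_, ?_, ?_, ?_, ?_⟩
        · rw [Fin.strictMono_iff_lt_succ]
          intro i
          cases i using Fin.cases with
          | zero => simp
          | succ i =>
            rw [← Fin.succ_castSucc, Fin.cons_succ, Fin.cons_succ]
            exact Fin.strictMono_succ (hr (Fin.castSucc_lt_succ))
        · rw [Fin.monotone_iff_le_succ]
          intro i
          cases n with
          | zero => exact i.elim0
          | succ m =>
            cases i using Fin.cases with
            | zero => simp
            | succ i =>
              rw [← Fin.succ_castSucc, Fin.cons_succ, Fin.cons_succ]
              exact Fin.strictMono_succ.monotone (hβ (Fin.castSucc_lt_succ).le)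
        · intro i
          cases i using Fin.cases with
          | zero => simp
          | succ i => simp [hβr]
        · intro i
          cases i using Fin.cases with
          | zero => simp; linarith
          | succ i => simpa [pow_succ] using hpos i
        · intro j
          cases j using Fin.cases with
          | zero => simp; linarith
          | succ j => simpa [pow_succ] using hnn j
        · intro hne
          cases n with
          | zero => exact (r 0).elim0
          | succ m =>
            rw [adjacentSignChanges_succ, hadj (fun j => hne _), if_pos]
            have h1 := hnn 0
            rw [hβ0 0 rfl] at h1
            simp only [Fin.val_zero, pow_zero, mul_one] at h1
            change 0 ≤ ε * x 1 at h1
            have h5 : x 1 ≠ 0 := hne 1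
            have h4 : ε ≠ 0 := by rintro rfl; simp at h0
            have h6 : 0 < ε * x 1 := lt_of_le_of_ne h1 (mul_ne_zero h4 h5).symm
            have := mul_neg_of_neg_of_pos h0 h6
            refine neg_of_mul_neg_right (a := ε ^ 2) ?_ (sq_nonneg _)
            nlinarith

/-! ### Total positivity implies variation diminution. -/

/-- Expansion of the determinant of a product of rectangular matrices over the choices of columns
of the left factor. -/
lemma det_mul_eq_sum_columns {m q : ℕ} (N : Matrix (Fin q) (Fin m) ℝ)
    (D : Matrix (Fin m) (Fin q) ℝ) :
    (N * D).det = ∑ f : Fin q → Fin m, (∏ k, D (f k) k) * (N.submatrix id f).det := by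
  rw [← Matrix.det_transpose]
  have h1 : (N * D)ᵀ = fun k => ∑ j, D j k • fun i => N i j := by
    ext k i
    simp [Matrix.mul_apply, mul_comm]
  have h2 := (Matrix.detRowAlternating (R := ℝ) (n := Fin q)).toMultilinearMap.map_sum
    (fun k (j : Fin m) => D j k • fun i => N i j)
  rw [h1]
  refine h2.trans (Finset.sum_congr rfl fun f _ => ?_)
  rw [MultilinearMap.map_smul_univ, smul_eq_mul]
  congr 1
  exact Matrix.det_transpose (N.submatrix id f)

/-- The matrix whose columns are sums, with nonnegative weights, over consecutive blocks of columns
of a totally positive matrix has positive minors. -/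
lemma det_block_pos {n p q : ℕ} {M : Matrix (Fin n) (Fin n) ℝ} (hM : IsTotallyPositive M)
    {r : Fin (p + 1) → Fin n} {β : Fin n → Fin (p + 1)} {w : Fin n → ℝ} (hr : StrictMono r)
    (hβ : Monotone β) (hβr : ∀ i, β (r i) = i) (hw : ∀ j, 0 ≤ w j) (hwr : ∀ i, 0 < w (r i))
    {a : Fin q → Fin n} (ha : StrictMono a) {b : Fin q → Fin (p + 1)} (hb : StrictMono b) :
    0 < (M.submatrix a id * Matrix.of fun j k => if β j = b k then w j else 0).det := by
  rw [det_mul_eq_sum_columns]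
  apply Finset.sum_pos'
  · intro f _
    by_cases hf : ∀ k, β (f k) = b k
    · refine mul_nonneg (Finset.prod_nonneg fun k _ => by simp [hf, hw]) ?_
      refine (hM q a f ha fun k l hkl => ?_).le
      -- A choice of columns compatible with the blocks is automatically increasing, so its minor is
      -- positive.
      by_contra hle
      have := hβ (not_lt.1 hle)
      rw [hf, hf] at this
      exact absurd (hb hkl) (not_lt.2 this)
    · push Not at hf
      obtain ⟨k, hk⟩ := hf
      rw [Finset.prod_eq_zero (Finset.mem_univ k) (by simp [hk]), zero_mul]
  -- The block representatives have positive weight and supply one strictly positive term.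
  · refine ⟨fun k => r (b k), Finset.mem_univ _, mul_pos (Finset.prod_pos fun k _ => ?_) ?_⟩
    · simp [hβr, hwr]
    · exact hM q a _ ha (hr.comp hb)

/-- Merging the columns of each block with weights `|ε x j|` gives a square matrix `B` that maps the
alternating vector to the chosen entries of `ε M x`. By Cramer's rule for coordinate `0`, `det B` is
an alternating sum of these entries against positive minors, so weak alternation with sign `δ` gives
`0 ≤ ε δ det B`, and `det B > 0`. -/
lemma sign_eq_of_block {n p : ℕ} {M : Matrix (Fin n) (Fin n) ℝ} (hM : IsTotallyPositive M)
    {x : Fin n → ℝ} {ε δ : ℝ} (hδ : δ ≠ 0) {r : Fin (p + 1) → Fin n} {β : Fin n → Fin (p + 1)}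
    (hr : StrictMono r) (hβ : Monotone β) (hβr : ∀ i, β (r i) = i)
    (hpos : ∀ i : Fin (p + 1), 0 < ε * (-1) ^ (i : ℕ) * x (r i))
    (hnn : ∀ j, 0 ≤ ε * (-1) ^ (β j : ℕ) * x j) (h : WeakAlt δ (M *ᵥ x) p) : 0 < ε * δ := by
  obtain ⟨s, hs, h⟩ := h
  have hε : ε ≠ 0 := by rintro rfl; simpa using hpos 0
  set w : Fin n → ℝ := fun j => ε * (-1) ^ (β j : ℕ) * x j
  have hwr : ∀ i, 0 < w (r i) := fun i => by simpa [w, hβr] using hpos i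
  set B : Matrix (Fin (p + 1)) (Fin (p + 1)) ℝ :=
    M.submatrix s id * Matrix.of fun j k => if β j = k then w j else 0
  have hB : 0 < B.det := det_block_pos hM hr hβ hβr hnn hwr hs (b := id) strictMono_id
  have hmin : ∀ i : Fin (p + 1), 0 < (B.submatrix i.succAbove Fin.succ).det := fun i =>
    det_block_pos hM hr hβ hβr hnn hwr (a := s ∘ i.succAbove) (b := Fin.succ)
      (hs.comp (Fin.strictMono_succAbove i)) Fin.strictMono_succ
  have hBe : (B *ᵥ fun k : Fin (p + 1) => (-1 : ℝ) ^ (k : ℕ)) = fun i => ε * (M *ᵥ x) (s i) := by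
    rw [← Matrix.mulVec_mulVec]
    have : (Matrix.of fun j k => if β j = k then w j else 0) *ᵥ
        (fun k : Fin (p + 1) => (-1 : ℝ) ^ (k : ℕ)) = ε • x := by
      ext j
      simp only [Matrix.mulVec, dotProduct, Matrix.of_apply, ite_mul, zero_mul, Finset.sum_ite_eq,
        Finset.mem_univ, if_true, w, Pi.smul_apply, smul_eq_mul]
      linear_combination ε * x j * neg_one_pow_sq (β j)
    rw [this, Matrix.mulVec_smul]
    ext i
    simp [Matrix.mulVec, dotProduct]
  have hcr : B.det = ∑ i : Fin (p + 1),
      ε * ((-1) ^ (i : ℕ) * (M *ᵥ x) (s i)) * (B.submatrix i.succAbove Fin.succ).det := by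
    have h1 := congrFun (congrArg (B.adjugate *ᵥ ·) hBe) 0
    simp only [Matrix.mulVec_mulVec, Matrix.adjugate_mul, Matrix.smul_mulVec, Matrix.one_mulVec,
      Pi.smul_apply, Fin.val_zero, pow_zero, smul_eq_mul, mul_one] at h1
    rw [h1]
    simp only [Matrix.mulVec, dotProduct]
    refine Finset.sum_congr rfl fun i _ => ?_
    rw [Matrix.adjugate_fin_succ_eq_det_submatrix]
    simp
    ring
  have hsum : 0 ≤ ε * δ * B.det := by
    rw [hcr, Finset.mul_sum]
    refine Finset.sum_nonneg fun i _ => ?_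
    have := mul_nonneg (mul_nonneg (sq_nonneg ε) (h i)) (hmin i).le
    convert this using 1
    ring
  exact lt_of_le_of_ne (nonneg_of_mul_nonneg_left hsum hB) (mul_ne_zero hε hδ).symm

/-- The variation diminishing property, including the information on the signs. -/
def VariationDiminishing {n : ℕ} (M : Matrix (Fin n) (Fin n) ℝ) : Prop :=
  ∀ x : Fin n → ℝ, x ≠ 0 → ∀ ε : ℝ, ε ≠ 0 → ∀ k, WeakAlt ε (M *ᵥ x) k → StrongAlt ε x k

/-- Let `p` be the number of sign changes of `x`. Below `p` both leading signs occur; at `p` the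
sign is forced by `sign_eq_of_block`; above `p` the image would alternate `p` times with both
leading signs, which forces contradictory signs. -/
theorem IsTotallyPositive.variationDiminishing {n : ℕ} {M : Matrix (Fin n) (Fin n) ℝ}
    (hM : IsTotallyPositive M) : VariationDiminishing M := by
  intro x hx δ hδ k h
  obtain ⟨p, ε, r, β, hr, hβ, hβr, hpos, hnn, -⟩ := exists_block x hx
  have key : ∀ δ : ℝ, δ ≠ 0 → WeakAlt δ (M *ᵥ x) p → 0 < ε * δ := fun δ hδ h =>
    sign_eq_of_block hM hδ hr hβ hβr hpos hnn h
  have hS : StrongAlt ε x p := ⟨r, hr, hpos⟩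
  rcases lt_trichotomy k p with hk | rfl | hk
  · exact hS.of_lt hk hδ
  · exact hS.sign_congr (key δ hδ h)
  · have h' := h.mono (Nat.succ_le_of_lt hk)
    have h1 := key δ hδ h'.init
    have h2 := key (-δ) (neg_ne_zero.2 hδ) h'.tail
    linarith

/-! ### Sign definite vectors, the set `𝒱` and `σ`. -/

/-- The largest number of sign changes of a subsequence of a nonzero vector. -/
lemma exists_max_strongAlt {n : ℕ} (x : Fin n → ℝ) (hx : x ≠ 0) :
    ∃ p : ℕ, (∃ ε, StrongAlt ε x p) ∧ (∀ ε k, StrongAlt ε x k → k ≤ p) ∧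
      ((∀ j, x j ≠ 0) → adjacentSignChanges x = p) := by
  obtain ⟨p, ε, r, β, hr, hβ, hβr, hpos, hnn, hadj⟩ := exists_block x hx
  refine ⟨p, ⟨ε, r, hr, hpos⟩, ?_, hadj⟩
  rintro δ k ⟨s, hs, h⟩
  -- Consecutive terms of a strict alternation cannot share a block, so there are at most as many
  -- terms as blocks.
  have hmono : StrictMono fun i => β (s i) := by
    rw [Fin.strictMono_iff_lt_succ]
    intro i
    refine lt_of_le_of_ne (hβ (hs (Fin.castSucc_lt_succ)).le) fun heq => ?_
    have h1 := hnn (s i.castSucc)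
    have h2 := hnn (s i.succ)
    rw [heq] at h1
    have h3 := h i.castSucc
    have h4 := h i.succ
    have h5 := mul_nonneg h1 h2
    have h6 := mul_pos h3 h4
    simp only [Fin.val_castSucc, Fin.val_succ, pow_succ] at h6
    have e1 := neg_one_pow_sq (i : ℕ)
    have e2 := neg_one_pow_sq (β (s i.succ) : ℕ)
    have h5' : 0 ≤ ε ^ 2 * (x (s i.castSucc) * x (s i.succ)) := by
      refine h5.trans_eq ?_
      linear_combination ε ^ 2 * (x (s i.castSucc) * x (s i.succ)) * e2
    have h6' : 0 < - (δ ^ 2 * (x (s i.castSucc) * x (s i.succ))) := by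
      refine h6.trans_eq ?_
      linear_combination - δ ^ 2 * (x (s i.castSucc) * x (s i.succ)) * e1
    have hε : 0 < ε ^ 2 := by
      have : ε ≠ 0 := by rintro rfl; simpa using hpos 0
      positivity
    have := nonneg_of_mul_nonneg_right h5' hε
    have := mul_nonneg (sq_nonneg δ) this
    linarith
  simpa using Fintype.card_le_of_injective _ hmono.injective

lemma isOpen_strongAlt {n : ℕ} (ε : ℝ) (k : ℕ) : IsOpen {y : Fin n → ℝ | StrongAlt ε y k} := by
  have : {y : Fin n → ℝ | StrongAlt ε y k} = ⋃ r : Fin (k + 1) → Fin n,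
      {y | StrictMono r ∧ ∀ i : Fin (k + 1), 0 < ε * (-1) ^ (i : ℕ) * y (r i)} := by
    ext y; simp [StrongAlt]
  rw [this]
  refine isOpen_iUnion fun r => isOpen_const.inter ?_
  change IsOpen {y : Fin n → ℝ | ∀ i : Fin (k + 1), 0 < ε * (-1) ^ (i : ℕ) * y (r i)}
  rw [ofPred_forall]
  exact isOpen_iInter_of_finite fun i => isOpen_lt continuous_const (by fun_prop)

lemma isClosed_weakAlt {n : ℕ} (ε : ℝ) (k : ℕ) : IsClosed {y : Fin n → ℝ | WeakAlt ε y k} := by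
  have : {y : Fin n → ℝ | WeakAlt ε y k} = ⋃ r : Fin (k + 1) → Fin n,
      {y | StrictMono r ∧ ∀ i : Fin (k + 1), 0 ≤ ε * (-1) ^ (i : ℕ) * y (r i)} := by
    ext y; simp [WeakAlt]
  rw [this]
  refine isClosed_iUnion_of_finite fun r => isClosed_const.inter ?_
  change IsClosed {y : Fin n → ℝ | ∀ i : Fin (k + 1), 0 ≤ ε * (-1) ^ (i : ℕ) * y (r i)}
  rw [ofPred_forall]
  exact isClosed_iInter fun i => isClosed_le continuous_const (by fun_prop)

/-- Every weakly alternating sign pattern of `y` is attained strictly. -/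
def SignDefinite {n : ℕ} (y : Fin n → ℝ) : Prop :=
  ∀ ε : ℝ, ε ≠ 0 → ∀ k, WeakAlt ε y k → StrongAlt ε y k

lemma SignDefinite.ne_zero {n : ℕ} (hn : 0 < n) {y : Fin n → ℝ} (hy : SignDefinite y) :
    y ≠ 0 := by
  rintro rfl
  exact (hy 1 one_ne_zero 0 (WeakAlt.zero_of_nonneg _ ⟨0, hn⟩ (by simp))).vec_ne_zero rfl

/-- Zeros of `y` may be filled with any signs without altering the count: alternations of `y`
survive in `w`, and those of `w` are weak alternations of `y`, hence attained strictly. -/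
lemma SignDefinite.adjacentSignChanges_eq {n : ℕ} {y : Fin n → ℝ} (hy : SignDefinite y) {p : ℕ}
    (hp : ∃ ε, StrongAlt ε y p) (hmax : ∀ ε k, StrongAlt ε y k → k ≤ p) {w : Fin n → ℝ}
    (hw : ∀ j, w j ≠ 0) (hwy : ∀ j, y j ≠ 0 → 0 < w j * y j) : adjacentSignChanges w = p := by
  obtain ⟨ε, hε⟩ := hp
  have hw0 : w ≠ 0 := by
    obtain ⟨r, -⟩ := hε
    intro h
    exact hw (r 0) (congrFun h _)
  obtain ⟨q, ⟨δ, hδ⟩, hmaxq, hadj⟩ := exists_max_strongAlt w hw0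
  rw [hadj hw]
  have key : ∀ (a u v : ℝ), 0 < a * u → 0 < u * v → 0 < a * v := fun a u v h1 h2 => by
    have := mul_pos h1 h2
    refine pos_of_mul_pos_right (a := u ^ 2) ?_ (sq_nonneg _)
    nlinarith
  apply le_antisymm
  · apply hmax δ
    apply hy δ hδ.ne_zero
    obtain ⟨r, hr, h⟩ := hδ
    refine ⟨r, hr, fun i : Fin (q + 1) => ?_⟩
    by_cases h0 : y (r i) = 0
    · simp [h0]
    · exact (key _ _ _ (h i) (hwy _ h0)).le
  · apply hmaxq ε
    obtain ⟨r, hr, h⟩ := hε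
    refine ⟨r, hr, fun i : Fin (p + 1) => key _ _ _ (h i) ?_⟩
    rw [mul_comm]
    exact hwy _ fun h0 => by simpa [h0] using h i

/-- Fill the zero at `l` with the sign of `s` or with the opposite one. All neighbours carry the
sign of `s` after filling, so the second choice has strictly more adjacent changes, although both
counts must equal `p`. -/
lemma SignDefinite.false_of_neighbours {n : ℕ} {y : Fin n → ℝ} (hy : SignDefinite y) {l : Fin n}
    (hl : y l = 0) {s : ℝ} (hs : s ≠ 0)
    (hnb : ∀ j : Fin n, (j : ℕ) + 1 = l ∨ (l : ℕ) + 1 = j → 0 ≤ y j * s)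
    (hex : ∃ j : Fin n, (j : ℕ) + 1 = l ∨ (l : ℕ) + 1 = j) : False := by
  obtain ⟨p, hp, hmax, -⟩ := exists_max_strongAlt y (hy.ne_zero l.pos)
  set w : ℝ → Fin n → ℝ := fun δ j => if j = l then δ * s else if y j = 0 then s else y j
  have hww : ∀ δ, δ ≠ 0 → adjacentSignChanges (w δ) = p := fun δ hδ => by
    apply hy.adjacentSignChanges_eq hp hmax
    · intro j
      simp only [w]
      split_ifs with h1 h2
      · exact mul_ne_zero hδ hs
      · exact hs
      · exact h2
    · intro j hj
      have : j ≠ l := by rintro rfl; exact hj hl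
      simp [w, this, hj, mul_self_pos]
  have hwl : ∀ δ, w δ l = δ * s := fun δ => by simp [w]
  have hwne : ∀ δ j, j ≠ l → w δ j = w 1 j := fun δ j hj => by simp [w, hj]
  have hwnb : ∀ δ (j : Fin n), (j : ℕ) + 1 = l ∨ (l : ℕ) + 1 = j → 0 < w δ j * s := by
    intro δ j hj
    have hne : j ≠ l := by rintro rfl; omega
    simp only [w, if_neg hne]
    split_ifs with h
    · exact mul_self_pos.2 hs
    · exact lt_of_le_of_ne (hnb j hj) (mul_ne_zero h hs).symm
  have hlt : adjacentSignChanges (w 1) < adjacentSignChanges (w (-1)) := by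
    apply ncard_lt_ncard _ (toFinite _)
    rw [ssubset_iff_of_subset]
    · obtain ⟨j, hj⟩ := hex
      rcases hj with h | h
      · refine ⟨(j, l), ⟨h, ?_⟩, fun h' => ?_⟩
        · have := hwnb (-1) j (Or.inl h)
          simp only [hwl]; linarith
        · have := hwnb 1 j (Or.inl h)
          have h2 := h'.2
          simp only [hwl] at h2; linarith
      · refine ⟨(l, j), ⟨h, ?_⟩, fun h' => ?_⟩
        · have := hwnb (-1) j (Or.inr h)
          simp only [hwl]; linarith
        · have := hwnb 1 j (Or.inr h)
          have h2 := h'.2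
          simp only [hwl] at h2; linarith
    · rintro ⟨a, b⟩ ⟨h1, h2⟩
      refine ⟨h1, ?_⟩
      dsimp only at h1 h2 ⊢
      by_cases ha : a = l
      · subst ha
        have := hwnb 1 b (Or.inr h1)
        rw [hwl] at h2; linarith
      by_cases hb : b = l
      · subst hb
        have := hwnb 1 a (Or.inl h1)
        rw [hwl] at h2; linarith
      rwa [hwne _ _ ha, hwne _ _ hb]
  rw [hww 1 one_ne_zero, hww (-1) (by norm_num)] at hlt
  exact lt_irrefl _ hlt

theorem SignDefinite.mem_signSet {n : ℕ} {y : Fin n → ℝ} (hy : SignDefinite y) :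
    y ∈ signSet n := by
  constructor
  · intro k hk h0
    have hend : ∀ i j : Fin n, ((i : ℕ) + 1 = k ∨ (k : ℕ) + 1 = i) →
        ((j : ℕ) + 1 = k ∨ (k : ℕ) + 1 = j) → i = j := by
      intro i j hi hj
      ext
      omega
    by_cases hex : ∃ j : Fin n, (j : ℕ) + 1 = k ∨ (k : ℕ) + 1 = j
    · obtain ⟨j, hj⟩ := hex
      refine hy.false_of_neighbours h0 (s := if y j = 0 then 1 else y j) ?_ ?_ ⟨j, hj⟩
      · split_ifs with h
        · exact one_ne_zero
        · exact h
      · intro i hi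
        rw [hend i j hi hj]
        split_ifs with h
        · simp [h]
        · exact mul_self_nonneg _
    · apply hy.ne_zero k.pos
      ext i
      rcases lt_trichotomy i k with h | h | h
      · exact absurd ⟨⟨k - 1, by omega⟩, Or.inl (by dsimp only; omega)⟩ hex
      · rw [h, h0]; rfl
      · exact absurd ⟨⟨k + 1, by omega⟩, Or.inr rfl⟩ hex
  · intro k l m hkl hlm h0
    by_contra hneg
    push Not at hneg
    refine hy.false_of_neighbours h0
      (s := if y k = 0 then if y m = 0 then 1 else y m else y k) ?_ ?_ ⟨k, Or.inl hkl⟩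
    · split_ifs with h1 h2
      · exact one_ne_zero
      · exact h2
      · exact h1
    · intro j hj
      have : j = k ∨ j = m := by
        rcases hj with hj | hj
        · left; ext; omega
        · right; ext; omega
      rcases this with rfl | rfl
      · split_ifs with h1 h2
        · simp [h1]
        · simp [h1]
        · exact mul_self_nonneg _
      · split_ifs with h1 h2
        · simp [h2]
        · exact mul_self_nonneg _
        · rwa [mul_comm]

/-- Nearby vectors without zeros are fillings of `y`, so the count is locally constant on them. -/
theorem SignDefinite.signVariations_eq {n : ℕ} {y : Fin n → ℝ} (hy : SignDefinite y) {p : ℕ}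
    (hp : ∃ ε, StrongAlt ε y p) (hmax : ∀ ε k, StrongAlt ε y k → k ≤ p) :
    signVariations y = p := by
  apply extendFrom_eq
  · have : {x : Fin n → ℝ | ∀ k, x k ≠ 0} = Set.pi univ fun _ => {0}ᶜ := by
      ext x; simp
    rw [this, closure_pi_set]
    intro i _
    simp
  · refine tendsto_const_nhds.congr' ?_
    have hev : ∀ᶠ w in 𝓝 y, ∀ j, y j ≠ 0 → 0 < w j * y j := by
      rw [eventually_all]
      intro j
      by_cases hj : y j = 0
      · simp [hj]
      · have hc : Continuous fun w : Fin n → ℝ => w j * y j := by fun_prop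
        filter_upwards [hc.continuousAt.eventually (lt_mem_nhds (mul_self_pos.2 hj))] with w hw _
        exact hw
    filter_upwards [nhdsWithin_le_nhds hev, self_mem_nhdsWithin] with w hw hw0
    exact (hy.adjacentSignChanges_eq hp hmax hw0 hw).symm

/-! ### Carathéodory solutions and the transition matrix. -/

lemma AbsolutelyContinuousOnInterval.eval {n : ℕ} {z : ℝ → Fin n → ℝ} {a b : ℝ}
    (h : AbsolutelyContinuousOnInterval z a b) (i : Fin n) :
    AbsolutelyContinuousOnInterval (fun t => z t i) a b := by
  refine squeeze_zero (fun E => ?_) (fun E => ?_) h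
  · exact Finset.sum_nonneg fun _ _ => dist_nonneg
  · exact Finset.sum_le_sum fun k _ => dist_le_pi_dist _ _ i

lemma AbsolutelyContinuousOnInterval.finset_sum {ι : Type*} {s : Finset ι} {f : ι → ℝ → ℝ}
    {a b : ℝ} (h : ∀ i ∈ s, AbsolutelyContinuousOnInterval (f i) a b) :
    AbsolutelyContinuousOnInterval (fun t => ∑ i ∈ s, f i t) a b := by
  classical
  induction s using Finset.induction_on with
  | empty =>
    simp only [Finset.sum_empty]
    exact ((LipschitzWith.const 0).lipschitzOnWith (s := uIcc a b)).absolutelyContinuousOnInterval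
  | insert i s hi ih =>
    simp only [Finset.sum_insert hi]
    exact (h i (Finset.mem_insert_self _ _)).fun_add
      (ih fun j hj => h j (Finset.mem_insert_of_mem hj))

lemma AbsolutelyContinuousOnInterval.comp_add_const {X : Type*} [PseudoMetricSpace X]
    {f : ℝ → X} {a b T : ℝ} (h : AbsolutelyContinuousOnInterval f (a + T) (b + T)) :
    AbsolutelyContinuousOnInterval (fun t => f (t + T)) a b := by
  rw [absolutelyContinuousOnInterval_iff] at h ⊢
  intro ε hε
  obtain ⟨δ, hδ, h⟩ := h ε hε
  refine ⟨δ, hδ, fun E hE hlen => ?_⟩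
  refine h (E.1, fun i => ((E.2 i).1 + T, (E.2 i).2 + T)) ⟨fun i hi => ?_, ?_⟩ (by simpa using hlen)
  · have := hE.1 i hi
    simp only [mem_uIcc] at this ⊢
    constructor <;> grind
  · intro i hi j hj hij
    have := hE.2 hi hj hij
    rw [Function.onFun, disjoint_left] at this ⊢
    intro t ht ht'
    refine this (a := t - T) ?_ ?_
    · simp only [mem_uIoc] at ht ⊢; grind
    · simp only [mem_uIoc] at ht' ⊢; grind

lemma AbsolutelyContinuousOnInterval.le_of_ae_deriv_nonpos {f : ℝ → ℝ} {a b : ℝ} (hab : a ≤ b)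
    (h : AbsolutelyContinuousOnInterval f a b) (hd : ∀ᵐ t, t ∈ Icc a b → deriv f t ≤ 0) :
    f b ≤ f a := by
  have h1 : ∫ t in a..b, deriv f t ≤ 0 := by
    rw [intervalIntegral.integral_of_le hab]
    apply integral_nonpos_of_ae
    filter_upwards [ae_restrict_of_ae hd, ae_restrict_mem measurableSet_Ioc] with t ht ht'
    exact ht (Ioc_subset_Icc_self ht')
  rw [h.integral_deriv_eq_sub] at h1
  linarith

/-- Forward uniqueness for linear Carathéodory equations. -/
lemma solution_eq_zero {n : ℕ} {A : ℝ → Matrix (Fin n) (Fin n) ℝ}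
    (hA : IsLocallyEssBoundedMeasurable A) {z : ℝ → Fin n → ℝ} {a b : ℝ} (hab : a ≤ b)
    (hac : AbsolutelyContinuousOnInterval z a b)
    (hz : ∀ᵐ t, t ∈ Icc a b → HasDerivAt z (A t *ᵥ z t) t) (h0 : z a = 0) : z b = 0 := by
  obtain ⟨C, hC⟩ := hA.2 a b
  -- Grönwall argument: with this rate, `exp (-K t)` times the squared Euclidean norm is
  -- nonincreasing.
  set K : ℝ := 2 * (C * n)
  set g : ℝ → ℝ := fun t => ∑ i, z t i * z t i
  have hg : AbsolutelyContinuousOnInterval g a b :=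
    AbsolutelyContinuousOnInterval.finset_sum fun i _ => (hac.eval i).fun_mul (hac.eval i)
  have he : AbsolutelyContinuousOnInterval (fun t => Real.exp (-K * t)) a b := by
    apply ContDiffOn.absolutelyContinuousOnInterval
    exact ContDiff.contDiffOn (by fun_prop)
  have hle := (hg.fun_mul he).le_of_ae_deriv_nonpos hab (by
    filter_upwards [hz, hC] with t ht hCt htab
    have hdz := hasDerivAt_pi.1 (ht htab)
    have hdg : HasDerivAt g (∑ i, ((A t *ᵥ z t) i * z t i + z t i * (A t *ᵥ z t) i)) t :=
      HasDerivAt.fun_sum fun i _ => (hdz i).fun_mul (hdz i)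
    have hde : HasDerivAt (fun t => Real.exp (-K * t)) (Real.exp (-K * t) * (-K)) t := by
      simpa using ((hasDerivAt_id t).const_mul (-K)).exp
    rw [(hdg.fun_mul hde).deriv]
    have hbd : ∑ i, ((A t *ᵥ z t) i * z t i + z t i * (A t *ᵥ z t) i) ≤ K * g t := by
      have h1 : ∀ i, (A t *ᵥ z t) i * z t i + z t i * (A t *ᵥ z t) i ≤
          ∑ j, C * (z t j * z t j + z t i * z t i) := fun i => by
        have : (A t *ᵥ z t) i * z t i + z t i * (A t *ᵥ z t) i =
            ∑ j, A t i j * (2 * (z t j * z t i)) := by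
          simp only [Matrix.mulVec, dotProduct]
          rw [mul_comm (z t i), ← two_mul, Finset.sum_mul, Finset.mul_sum]
          exact Finset.sum_congr rfl fun j _ => by ring
        rw [this]
        refine Finset.sum_le_sum fun j _ => ?_
        have h2 : |2 * (z t j * z t i)| ≤ z t j * z t j + z t i * z t i :=
          abs_le.2 ⟨by nlinarith [sq_nonneg (z t j + z t i)],
            by nlinarith [sq_nonneg (z t j - z t i)]⟩
        calc _ ≤ |A t i j * (2 * (z t j * z t i))| := le_abs_self _
          _ = |A t i j| * |2 * (z t j * z t i)| := abs_mul _ _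
          _ ≤ C * (z t j * z t j + z t i * z t i) :=
            mul_le_mul (hCt htab i j) h2 (abs_nonneg _) ((abs_nonneg _).trans (hCt htab i j))
      refine (Finset.sum_le_sum fun i _ => h1 i).trans_eq ?_
      have h3 : ∀ u : Fin n → ℝ, ∑ i, ∑ j, C * (u j + u i) = 2 * (C * n) * ∑ i, u i := fun u => by
        simp only [← Finset.mul_sum, Finset.sum_add_distrib, Finset.sum_const, Finset.card_univ,
          Fintype.card_fin, nsmul_eq_mul]
        ring
      exact h3 fun i => z t i * z t i
    have := mul_nonneg (sub_nonneg.2 hbd) (Real.exp_pos (-K * t)).le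
    linarith)
  have hga : g a = 0 := by simp [g, h0]
  simp only [hga, zero_mul] at hle
  have hgb : g b ≤ 0 := nonpos_of_mul_nonpos_left hle (Real.exp_pos _)
  have hgb' : g b = 0 := le_antisymm hgb (Finset.sum_nonneg fun i _ => mul_self_nonneg _)
  ext i
  have := (Finset.sum_eq_zero_iff_of_nonneg fun i _ => mul_self_nonneg (z b i)).1 hgb' i
    (Finset.mem_univ i)
  simpa using this

section Solutions

variable {n : ℕ} {A : ℝ → Matrix (Fin n) (Fin n) ℝ} {I : Set ℝ} {z w : ℝ → Fin n → ℝ}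

lemma IsSolutionOn.add (hz : IsSolutionOn A I z) (hw : IsSolutionOn A I w) :
    IsSolutionOn A I (fun t => z t + w t) := by
  refine ⟨fun a b h => (hz.1 a b h).fun_add (hw.1 a b h), ?_⟩
  filter_upwards [hz.2, hw.2] with t h1 h2 ht
  rw [Matrix.mulVec_add]
  exact (h1 ht).add (h2 ht)

lemma IsSolutionOn.const_smul (c : ℝ) (hz : IsSolutionOn A I z) :
    IsSolutionOn A I (fun t => c • z t) := by
  refine ⟨fun a b h => (hz.1 a b h).const_smul c, ?_⟩
  filter_upwards [hz.2] with t h1 ht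
  rw [Matrix.mulVec_smul]
  exact (h1 ht).const_smul c

lemma isSolutionOn_zero : IsSolutionOn A I (fun _ => 0) := by
  refine ⟨fun a b h => ((LipschitzWith.const 0).lipschitzOnWith (s := uIcc a b)).absolutelyContinuousOnInterval, ?_⟩
  filter_upwards with t _
  rw [Matrix.mulVec_zero]
  exact hasDerivAt_const _ _

lemma IsSolutionOn.sum {ι : Type*} {s : Finset ι} {z : ι → ℝ → Fin n → ℝ}
    (hz : ∀ i ∈ s, IsSolutionOn A I (z i)) : IsSolutionOn A I (fun t => ∑ i ∈ s, z i t) := by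
  classical
  induction s using Finset.induction_on with
  | empty => simpa using isSolutionOn_zero
  | insert i s hi ih =>
    simp only [Finset.sum_insert hi]
    exact (hz i (Finset.mem_insert_self _ _)).add
      (ih fun j hj => hz j (Finset.mem_insert_of_mem hj))

lemma IsSolutionOn.mono {J : Set ℝ} (hz : IsSolutionOn A I z) (h : J ⊆ I) :
    IsSolutionOn A J z :=
  ⟨fun a b hab => hz.1 a b (hab.trans h), hz.2.mono fun _ ht htJ => ht (h htJ)⟩

lemma IsSolutionOn.eq_of_le (hA : IsLocallyEssBoundedMeasurable A) (hz : IsSolutionOn A I z)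
    (hw : IsSolutionOn A I w) {a b : ℝ} (hab : a ≤ b) (hI : Icc a b ⊆ I) (h0 : z a = w a) :
    z b = w b := by
  have hs := hz.add (hw.const_smul (-1))
  have := solution_eq_zero hA hab (hs.1 a b (by rwa [uIcc_of_le hab]))
    (hs.2.mono fun t ht htI => ht (hI htI)) (by simp [h0])
  simpa [← sub_eq_add_neg, sub_eq_zero] using this

lemma IsSolutionOn.comp_add_const {T : ℝ} (hz : IsSolutionOn A univ z)
    (hper : ∀ t, A (t + T) = A t) : IsSolutionOn A univ (fun t => z (t + T)) := by
  refine ⟨fun a b _ => (hz.1 _ _ (subset_univ _)).comp_add_const, ?_⟩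
  have hq := (measurePreserving_add_right (volume : Measure ℝ) T).quasiMeasurePreserving.ae hz.2
  filter_upwards [hq] with t ht _
  have := (ht (mem_univ _)).comp_add_const t T
  rwa [hper] at this

variable {Φ : ℝ → ℝ → Matrix (Fin n) (Fin n) ℝ}

lemma IsTransitionMatrix.isSolutionOn_mulVec (hΦ : IsTransitionMatrix A Φ) (s : ℝ)
    (v : Fin n → ℝ) : IsSolutionOn A univ (fun t => Φ t s *ᵥ v) := by
  have : (fun t => Φ t s *ᵥ v) = fun t => ∑ k, v k • (Φ t s).col k := by
    ext t i
    simp [Matrix.mulVec, dotProduct, mul_comm]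
  rw [this]
  exact IsSolutionOn.sum fun k _ => ((hΦ s).2 k).const_smul (v k)

lemma IsTransitionMatrix.continuous_mulVec (hΦ : IsTransitionMatrix A Φ) (s : ℝ)
    (v : Fin n → ℝ) : Continuous (fun t => Φ t s *ᵥ v) := by
  rw [continuous_iff_continuousAt]
  intro t
  have h := ((hΦ.isSolutionOn_mulVec s v).1 (t - 1) (t + 1) (subset_univ _)).continuousOn
  rw [uIcc_of_le (by linarith)] at h
  exact h.continuousAt (Icc_mem_nhds (by linarith) (by linarith))

lemma IsTransitionMatrix.eq_mulVec (hA : IsLocallyEssBoundedMeasurable A)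
    (hΦ : IsTransitionMatrix A Φ) {s t : ℝ} (hst : s ≤ t) (hz : IsSolutionOn A I z)
    (hI : Icc s t ⊆ I) : z t = Φ t s *ᵥ z s :=
  hz.eq_of_le hA ((hΦ.isSolutionOn_mulVec s (z s)).mono (subset_univ _)) hst hI
    (by rw [(hΦ s).1, Matrix.one_mulVec])

/-- Forward uniqueness is enough here. The time `r` is unrestricted because the columns of `Φ · r`
solve on the whole line; `r = t` then gives invertibility. -/
lemma IsTransitionMatrix.mul_eq (hA : IsLocallyEssBoundedMeasurable A)
    (hΦ : IsTransitionMatrix A Φ) {s t : ℝ} (hst : s ≤ t) (r : ℝ) : Φ t s * Φ s r = Φ t r := by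
  apply Matrix.ext_of_mulVec_single
  intro k
  rw [← Matrix.mulVec_mulVec]
  exact (hΦ.eq_mulVec hA hst (hΦ.isSolutionOn_mulVec r (Pi.single k 1)) (subset_univ _)).symm

lemma IsTransitionMatrix.periodic (hA : IsLocallyEssBoundedMeasurable A)
    (hΦ : IsTransitionMatrix A Φ) {T : ℝ} (hper : ∀ t, A (t + T) = A t) {s t : ℝ}
    (hst : s ≤ t) : Φ (t + T) (s + T) = Φ t s := by
  apply Matrix.ext_of_mulVec_single
  intro k
  have := hΦ.eq_mulVec hA hst ((hΦ.isSolutionOn_mulVec (s + T) (Pi.single k 1)).comp_add_const hper)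
    (subset_univ _)
  rw [this, (hΦ (s + T)).1, Matrix.one_mulVec]

lemma IsTransitionMatrix.mul_swap (hA : IsLocallyEssBoundedMeasurable A)
    (hΦ : IsTransitionMatrix A Φ) {s t : ℝ} (hst : s ≤ t) : Φ t s * Φ s t = 1 := by
  rw [hΦ.mul_eq hA hst, (hΦ t).1]

/-- Continuity in the initial time comes from `Φ t s = Φ t r (Φ s r)⁻¹` and `Φ s r → 1`. -/
lemma IsTransitionMatrix.continuousWithinAt_right (hA : IsLocallyEssBoundedMeasurable A)
    (hΦ : IsTransitionMatrix A Φ) {r t : ℝ} (hrt : r < t) (v : Fin n → ℝ) :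
    Tendsto (fun s => Φ t s *ᵥ v) (𝓝[>] r) (𝓝 (Φ t r *ᵥ v)) := by
  have hc : Continuous fun s => Φ s r := by
    refine continuous_matrix fun i j => ?_
    simpa [Function.comp_def] using (continuous_apply i).comp (hΦ.continuous_mulVec r (Pi.single j 1))
  have hinv : Tendsto (fun s => (Φ s r)⁻¹) (𝓝 r) (𝓝 1) := by
    have h1 : ContinuousAt (fun s => (Φ s r).det⁻¹ • (Φ s r).adjugate) r := by
      refine ContinuousAt.smul (ContinuousAt.inv₀ hc.matrix_det.continuousAt ?_)
        hc.matrix_adjugate.continuousAt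
      simp [(hΦ r).1]
    have h2 := h1.tendsto
    simp only [(hΦ r).1, Matrix.det_one, inv_one, Matrix.adjugate_one, one_smul] at h2
    simpa [Matrix.inv_def] using h2
  have h3 : Tendsto (fun s => Φ t r *ᵥ ((Φ s r)⁻¹ *ᵥ v)) (𝓝 r) (𝓝 (Φ t r *ᵥ v)) := by
    have hcont : Continuous fun N : Matrix (Fin n) (Fin n) ℝ => Φ t r *ᵥ (N *ᵥ v) := by fun_prop
    simpa [Function.comp_def] using (hcont.tendsto 1).comp hinv
  refine (h3.mono_left nhdsWithin_le_nhds).congr' ?_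
  filter_upwards [Ioo_mem_nhdsGT hrt] with s hs
  rw [Matrix.mulVec_mulVec, ← hΦ.mul_eq hA hs.2.le r, mul_assoc, Matrix.mul_nonsing_inv, mul_one]
  have := congrArg Matrix.det (hΦ.mul_swap hA hs.1.le)
  rw [Matrix.det_mul, Matrix.det_one] at this
  exact IsUnit.of_mul_eq_one _ this

end Solutions

/-! ### Variation diminution along the flow. -/

/-- The zero vector alternates weakly at full length with both leading signs. Then `x` would
alternate strictly in both ways, along the only possible subsequence. -/
lemma VariationDiminishing.mulVec_ne_zero {n : ℕ} {M : Matrix (Fin n) (Fin n) ℝ}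
    (hM : VariationDiminishing M) {x : Fin n → ℝ} (hx : x ≠ 0) : M *ᵥ x ≠ 0 := by
  intro h0
  have h : ∀ k, k < n → StrongAlt 1 x k := fun k hk => hM x hx 1 one_ne_zero k (by
    rw [h0]
    exact ⟨Fin.castLE hk, Fin.strictMono_castLE hk, fun i => by simp⟩)
  have hn : 0 < n := by
    by_contra h
    obtain rfl : n = 0 := by omega
    exact hx (Subsingleton.elim _ _)
  have h' : StrongAlt (-1) x (n - 1) := hM x hx (-1) (by norm_num) _ (by
    rw [h0]
    exact ⟨Fin.castLE (by omega), Fin.strictMono_castLE (by omega), fun i => by simp⟩)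
  obtain ⟨r, hr, h1⟩ := h (n - 1) (by omega)
  obtain ⟨s, hs, h2⟩ := h'
  have hrs : r = s := by
    have hn1 : n - 1 + 1 = n := by omega
    have key : ∀ (m : ℕ) (_ : m = n) (u v : Fin m → Fin n), StrictMono u → StrictMono v →
        u = v := by
      rintro m rfl u v hu hv
      rw [← StrictMono.range_inj hu hv]
      rw [(Finite.surjective_of_injective hu.injective).range_eq,
        (Finite.surjective_of_injective hv.injective).range_eq]
    exact key _ hn1 r s hr hs
  subst hrs
  have h3 := h1 0
  have h4 := h2 0
  simp at h3 h4
  linarith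

lemma VariationDiminishing.mul {n : ℕ} {M N : Matrix (Fin n) (Fin n) ℝ}
    (hM : VariationDiminishing M) (hN : VariationDiminishing N) : VariationDiminishing (M * N) := by
  intro x hx ε hε k h
  rw [← Matrix.mulVec_mulVec] at h
  exact hN x hx ε hε k (hM _ (hN.mulVec_ne_zero hx) ε hε k h).weakAlt

/-- A limit of variation diminishing matrices does not increase strict sign changes. -/
lemma strongAlt_of_tendsto {n : ℕ} {ι : Type*} {l : Filter ι} [l.NeBot]
    {M : ι → Matrix (Fin n) (Fin n) ℝ} (hM : ∀ᶠ a in l, VariationDiminishing (M a))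
    {x y : Fin n → ℝ} (hlim : Tendsto (fun a => M a *ᵥ x) l (𝓝 y)) {ε : ℝ} {k : ℕ}
    (hx : x ≠ 0) (h : StrongAlt ε y k) : StrongAlt ε x k := by
  obtain ⟨a, ha, hs⟩ := (hM.and (hlim.eventually ((isOpen_strongAlt ε k).mem_nhds h))).exists
  exact ha x hx ε h.ne_zero k (StrongAlt.weakAlt hs)

/-- A matrix with a right inverse that does not increase strict sign changes does not increase weak
sign changes either. -/
lemma weakAlt_of_weakAlt_mulVec {n : ℕ} {N N' : Matrix (Fin n) (Fin n) ℝ} (hN' : N * N' = 1)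
    (hN : ∀ (x : Fin n → ℝ) (ε : ℝ) (k : ℕ), StrongAlt ε (N *ᵥ x) k → StrongAlt ε x k)
    {x : Fin n → ℝ} {ε : ℝ} {k : ℕ} (hε : ε ≠ 0) (h : WeakAlt ε (N *ᵥ x) k) : WeakAlt ε x k := by
  obtain ⟨r, hr, h⟩ := h
  -- Moving the image a little along `e` makes the weak alternation strict; the right inverse
  -- transports this perturbation back to `x`.
  obtain ⟨e, he⟩ : ∃ e : Fin n → ℝ, ∀ i : Fin (k + 1), e (r i) = ε * (-1) ^ (i : ℕ) :=
    ⟨Function.extend r (fun i : Fin (k + 1) => ε * (-1) ^ (i : ℕ)) 0,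
      fun i => hr.injective.extend_apply _ _ i⟩
  have h1 : ∀ δ : ℝ, 0 < δ → WeakAlt ε (x + δ • (N' *ᵥ e)) k := by
    intro δ hδ
    refine (hN _ ε k ⟨r, hr, fun i : Fin (k + 1) => ?_⟩).weakAlt
    rw [Matrix.mulVec_add, Matrix.mulVec_smul, Matrix.mulVec_mulVec, hN', Matrix.one_mulVec]
    simp only [Pi.add_apply, Pi.smul_apply, smul_eq_mul, he]
    have h2 : 0 < ε ^ 2 := by positivity
    have h3 := neg_one_pow_sq (i : ℕ)
    have h4 : ε * (-1) ^ (i : ℕ) * ((N *ᵥ x) (r i) + δ * (ε * (-1) ^ (i : ℕ))) =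
        ε * (-1) ^ (i : ℕ) * (N *ᵥ x) (r i) + δ * ε ^ 2 := by
      linear_combination δ * ε ^ 2 * h3
    rw [h4]
    have := h i
    positivity
  have hlim : Tendsto (fun δ : ℝ => x + δ • (N' *ᵥ e)) (𝓝[>] 0) (𝓝 x) := by
    have : Continuous fun δ : ℝ => x + δ • (N' *ᵥ e) := by fun_prop
    simpa using (this.tendsto 0).mono_left nhdsWithin_le_nhds
  refine (isClosed_weakAlt ε k).mem_of_tendsto hlim ?_
  filter_upwards [self_mem_nhdsWithin] with δ hδ
  exact h1 δ hδ

section Flow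

variable {n : ℕ} {A : ℝ → Matrix (Fin n) (Fin n) ℝ} {Φ : ℝ → ℝ → Matrix (Fin n) (Fin n) ℝ}

/-- Total positivity is assumed only on the open interval. Split off short pieces at both ends: as
limits they merely do not increase alternations, while the totally positive middle factor turns weak
alternation into strict. -/
lemma IsTPDS.variationDiminishing_of_le (hA : IsLocallyEssBoundedMeasurable A)
    (hΦ : IsTransitionMatrix A Φ) {T : ℝ} (hTP : IsTPDS Φ 0 T) {s t : ℝ} (hs : 0 ≤ s)
    (hst : s < t) (ht : t ≤ T) : VariationDiminishing (Φ t s) := by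
  intro x hx ε hε k h
  obtain ⟨s', h1, h2⟩ := exists_between hst
  obtain ⟨t', h3, h4⟩ := exists_between h2
  have hne : Φ s' s *ᵥ x ≠ 0 := by
    intro h0
    have hinv : Φ s s' * Φ s' s = 1 := mul_eq_one_comm.1 (hΦ.mul_swap hA h1.le)
    apply hx
    rw [← Matrix.one_mulVec x, ← hinv, ← Matrix.mulVec_mulVec, h0, Matrix.mulVec_zero]
  have hend : ∀ (x : Fin n → ℝ) (ε : ℝ) (k : ℕ), StrongAlt ε (Φ t t' *ᵥ x) k →
      StrongAlt ε x k := by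
    intro x ε k hx
    have hx0 : x ≠ 0 := by
      rintro rfl
      exact hx.vec_ne_zero (Matrix.mulVec_zero _)
    refine strongAlt_of_tendsto (l := 𝓝[<] t) (M := fun u => Φ u t') ?_
      (((hΦ.continuous_mulVec t' x).tendsto t).mono_left nhdsWithin_le_nhds) hx0 hx
    filter_upwards [Ioo_mem_nhdsLT h4] with u hu
    exact (hTP t' u (by linarith) hu.1 (by linarith [hu.2])).variationDiminishing
  have hstart : ∀ (x : Fin n → ℝ) (ε : ℝ) (k : ℕ), StrongAlt ε (Φ s' s *ᵥ x) k →
      StrongAlt ε x k := by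
    intro x ε k hx
    have hx0 : x ≠ 0 := by
      rintro rfl
      exact hx.vec_ne_zero (Matrix.mulVec_zero _)
    refine strongAlt_of_tendsto (l := 𝓝[>] s) (M := fun u => Φ s' u) ?_
      (hΦ.continuousWithinAt_right hA h1 x) hx0 hx
    filter_upwards [Ioo_mem_nhdsGT h1] with u hu
    exact (hTP u s' (by linarith [hu.1]) hu.2 (by linarith)).variationDiminishing
  have hmid := (hTP s' t' (by linarith) h3 (by linarith)).variationDiminishing
  rw [← hΦ.mul_eq hA h4.le, ← hΦ.mul_eq hA h3.le, ← Matrix.mulVec_mulVec,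
    ← Matrix.mulVec_mulVec] at h
  exact hstart x ε k
    (hmid _ hne ε hε k (weakAlt_of_weakAlt_mulVec (hΦ.mul_swap hA h4.le) hend hε h))

/-- Cut `[s, t]` at `T`, shift the remainder back by one period, and induct on the number of
periods. -/
theorem IsTPDS.variationDiminishing (hA : IsLocallyEssBoundedMeasurable A)
    (hΦ : IsTransitionMatrix A Φ) {T : ℝ} (hT : 0 < T) (hper : ∀ t, A (t + T) = A t)
    (hTP : IsTPDS Φ 0 T) {s t : ℝ} (hs : 0 ≤ s) (hst : s < t) :
    VariationDiminishing (Φ t s) := by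
  have key : ∀ (N : ℕ) (s t : ℝ), 0 ≤ s → s < t → t ≤ N * T → VariationDiminishing (Φ t s) := by
    intro N
    induction N with
    | zero =>
      intro s t hs hst ht
      simp at ht
      linarith
    | succ N ih =>
      intro s t hs hst ht
      push_cast at ht
      have hN : 0 ≤ (N : ℝ) * T := by positivity
      by_cases htT : t ≤ T
      · exact hTP.variationDiminishing_of_le hA hΦ hs hst htT
      have hshift : ∀ s t, T ≤ s → s < t → t ≤ (N + 1) * T → VariationDiminishing (Φ t s) := by
        intro s t hs hst ht
        have := hΦ.periodic hA hper (s := s - T) (t := t - T) (by linarith)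
        simp only [sub_add_cancel] at this
        rw [this]
        exact ih _ _ (by linarith) (by linarith) (by linarith)
      by_cases hsT : T ≤ s
      · exact hshift s t hsT hst ht
      push Not at htT hsT
      rw [← hΦ.mul_eq hA htT.le]
      exact (hshift T t le_rfl htT ht).mul (hTP.variationDiminishing_of_le hA hΦ hs hsT le_rfl)
  obtain ⟨N, hN⟩ := exists_nat_ge (t / T)
  exact key N s t hs hst ((div_le_iff₀ hT).1 hN)

end Flow

/-! ### The spectrum of a variation diminishing matrix. -/

/-- Of two alternations with opposite leading signs, the earlier first term can be put in front of
the other sequence. -/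
lemma StrongAlt.succ_of_opposite {n : ℕ} {y : Fin n → ℝ} {ε δ : ℝ} {k : ℕ}
    (h : StrongAlt ε y k) (h' : StrongAlt δ y k) (hεδ : ε * δ < 0) :
    ∃ η, StrongAlt η y (k + 1) := by
  have key : ∀ {ε δ : ℝ} (r s : Fin (k + 1) → Fin n), StrictMono s →
      (∀ i : Fin (k + 1), 0 < ε * (-1) ^ (i : ℕ) * y (r i)) →
      (∀ i : Fin (k + 1), 0 < δ * (-1) ^ (i : ℕ) * y (s i)) → ε * δ < 0 → r 0 < s 0 →
      StrongAlt ε y (k + 1) := by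
    intro ε δ r s hs h1 h2 hεδ h0
    refine ⟨Fin.cons (r 0) s, ?_, fun i : Fin (k + 2) => ?_⟩
    · rw [Fin.strictMono_iff_lt_succ]
      intro i
      cases i using Fin.cases with
      | zero => simpa using h0
      | succ i =>
        rw [← Fin.succ_castSucc, Fin.cons_succ, Fin.cons_succ]
        exact hs Fin.castSucc_lt_succ
    · cases i using Fin.cases with
      | zero => simpa using h1 0
      | succ i =>
        have h3 := mul_pos_of_neg_of_neg hεδ (neg_lt_zero.2 (h2 i))
        simp only [Fin.cons_succ, Fin.val_succ, pow_succ]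
        refine pos_of_mul_pos_right (a := δ ^ 2) ?_ (sq_nonneg _)
        nlinarith
  obtain ⟨r, hr, h1⟩ := h
  obtain ⟨s, hs, h2⟩ := h'
  rcases lt_trichotomy (r 0) (s 0) with h | h | h
  · exact ⟨_, key r s hs h1 h2 hεδ h⟩
  · exfalso
    have h3 := h1 0
    have h4 := h2 0
    rw [h] at h3
    simp only [Fin.val_zero, pow_zero, mul_one] at h3 h4
    have := mul_pos h3 h4
    nlinarith [mul_self_nonneg (y (s 0))]
  · exact ⟨_, key s r hr h2 h1 (by linarith) h⟩

namespace VariationDiminishing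

variable {n : ℕ} {M : Matrix (Fin n) (Fin n) ℝ}

lemma strongAlt (hM : VariationDiminishing M) {x : Fin n → ℝ} {ε : ℝ} {k : ℕ}
    (h : StrongAlt ε (M *ᵥ x) k) : StrongAlt ε x k := by
  refine hM x ?_ ε h.ne_zero k h.weakAlt
  rintro rfl
  exact h.vec_ne_zero (Matrix.mulVec_zero _)

lemma strongAlt_of_pow (hM : VariationDiminishing M) {x : Fin n → ℝ} {ε : ℝ} {k : ℕ} (m : ℕ)
    (h : StrongAlt ε ((M ^ m) *ᵥ x) k) : StrongAlt ε x k := by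
  induction m with
  | zero => simpa using h
  | succ m ih =>
    rw [pow_succ', ← Matrix.mulVec_mulVec] at h
    exact ih (hM.strongAlt h)

lemma pow_succ (hM : VariationDiminishing M) (m : ℕ) : VariationDiminishing (M ^ (m + 1)) := by
  induction m with
  | zero => simpa using hM
  | succ m ih =>
    rw [_root_.pow_succ]
    exact ih.mul hM

/-- Strict alternation is open, so some iterate already has it, and it pulls back to `x`. -/
lemma strongAlt_of_tendsto_pow (hM : VariationDiminishing M) {x y : Fin n → ℝ} {s : ℕ → ℝ}
    (hs : ∀ m, 0 < s m) (hlim : Tendsto (fun m => s m • ((M ^ m) *ᵥ x)) atTop (𝓝 y)) {ε : ℝ}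
    {k : ℕ} (h : StrongAlt ε y k) : StrongAlt ε x k := by
  obtain ⟨m, hm⟩ := (hlim.eventually ((isOpen_strongAlt ε k).mem_nhds h)).exists
  refine hM.strongAlt_of_pow m ((StrongAlt.of_smul hm).sign_congr ?_)
  have := h.ne_zero
  have h2 : 0 < ε ^ 2 := by positivity
  have := mul_pos (hs m) h2
  linarith

/-- Alternation of `x` pulls back to the backward iterates `u m`, and weak alternation is closed.
The index `m = 0` is discarded, since the identity need not diminish variation. -/
lemma weakAlt_of_tendsto_pow (hM : VariationDiminishing M) {x y : Fin n → ℝ} (hx : x ≠ 0)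
    {s : ℕ → ℝ} {u : ℕ → Fin n → ℝ} (hs : ∀ m, 0 < s m) (hu : ∀ m, (M ^ m) *ᵥ u m = x)
    (hlim : Tendsto (fun m => s m • u m) atTop (𝓝 y)) {ε : ℝ} {k : ℕ} (hε : ε ≠ 0)
    (h : WeakAlt ε x k) : WeakAlt ε y k := by
  refine (isClosed_weakAlt ε k).mem_of_tendsto hlim ?_
  filter_upwards [eventually_ge_atTop 1] with m hm
  obtain ⟨m, rfl⟩ := Nat.exists_eq_add_of_le' hm
  have hu0 : u (m + 1) ≠ 0 := by
    intro h0
    apply hx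
    rw [← hu (m + 1), h0, Matrix.mulVec_zero]
  rw [← hu (m + 1)] at h
  have h1 := hM.pow_succ m _ hu0 ε hε k h
  have h2 : StrongAlt (ε * (s (m + 1))⁻¹) (s (m + 1) • u (m + 1)) k := by
    obtain ⟨r, hr, h3⟩ := h1
    refine ⟨r, hr, fun i => ?_⟩
    have h4 := (hs (m + 1)).ne'
    have : ε * (s (m + 1))⁻¹ * (-1) ^ (i : ℕ) * (s (m + 1) • u (m + 1)) (r i) =
        ε * (-1) ^ (i : ℕ) * u (m + 1) (r i) := by
      simp only [Pi.smul_apply, smul_eq_mul]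
      field_simp
    rw [this]
    exact h3 i
  refine (h2.sign_congr ?_).weakAlt
  have h5 : 0 < ε ^ 2 := by positivity
  have h6 := inv_pos.2 (hs (m + 1))
  have := mul_pos h5 h6
  linarith

lemma signDefinite_of_eigenvector (hM : VariationDiminishing M) {q : Fin n → ℝ} (hq : q ≠ 0)
    {a : ℝ} (ha : 0 < a) (h : M *ᵥ q = a • q) : SignDefinite q := by
  intro ε hε k hk
  refine hM q hq ε hε k ?_
  rw [h]
  obtain ⟨r, hr, hk⟩ := hk
  refine ⟨r, hr, fun i => ?_⟩
  have := mul_nonneg ha.le (hk i)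
  simp only [Pi.smul_apply, smul_eq_mul]
  linarith

/-- A negative eigenvalue would give `q` a maximal alternation with either leading sign, hence a
longer one. -/
lemma eigenvalue_pos (hM : VariationDiminishing M) {q : Fin n → ℝ} (hq : q ≠ 0) {a : ℝ}
    (h : M *ᵥ q = a • q) : 0 < a := by
  by_contra hneg
  rcases lt_or_eq_of_le (not_lt.1 hneg) with ha | rfl
  · obtain ⟨p, ⟨ε, hε⟩, hmax, -⟩ := exists_max_strongAlt q hq
    have h1 : StrongAlt (-ε) q p := by
      refine hM q hq _ (neg_ne_zero.2 hε.ne_zero) p ?_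
      rw [h]
      obtain ⟨r, hr, hk⟩ := hε
      refine ⟨r, hr, fun i => ?_⟩
      have := mul_nonneg_of_nonpos_of_nonpos ha.le (neg_nonpos.2 (hk i).le)
      simp only [Pi.smul_apply, smul_eq_mul]
      linarith
    obtain ⟨η, hη⟩ := hε.succ_of_opposite h1 (by
      have := hε.ne_zero
      have : 0 < ε ^ 2 := by positivity
      linarith)
    exact absurd (hmax _ _ hη) (by omega)
  · exact hM.mulVec_ne_zero hq (by rw [h, zero_smul])

end VariationDiminishing

lemma SignDefinite.apply_zero_ne {n : ℕ} {y : Fin (n + 1) → ℝ} (hy : SignDefinite y) : y 0 ≠ 0 :=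
  hy.mem_signSet.1 0 (Or.inl rfl)

lemma exists_pow_mem_of_norm_eq_one {u : ℂ} (hu : ‖u‖ = 1) {U : Set ℂ} (hU : U ∈ 𝓝 (1 : ℂ)) :
    ∃ m : ℕ, u ^ (m + 1) ∈ U := by
  obtain ⟨ε, hε, hball⟩ := Metric.mem_nhds_iff.1 hU
  obtain ⟨a, -, φ, hφ, hlim⟩ := (isCompact_closedBall (0 : ℂ) 1).tendsto_subseq
    (x := fun m : ℕ => u ^ m) (fun m => by simp [hu])
  obtain ⟨N, hN⟩ := Metric.cauchySeq_iff.1 hlim.cauchySeq ε hε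
  have h1 := hN (N + 1) (by omega) N le_rfl
  have h2 : φ N < φ (N + 1) := hφ (by omega)
  obtain ⟨d, hd⟩ := Nat.exists_eq_add_of_lt h2
  refine ⟨d, hball ?_⟩
  simp only [Function.comp_apply, hd, dist_eq_norm] at h1
  have h3 : u ^ (φ N + d + 1) - u ^ φ N = u ^ φ N * (u ^ (d + 1) - 1) := by ring
  rw [h3, norm_mul, norm_pow, hu, one_pow, one_mul] at h1
  simpa [dist_eq_norm] using h1

namespace VariationDiminishing

/-- If `a` is not real, the vectors `Re (z v)` with `z ≠ 0` are nonzero and `M` sends them to `Re (z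
a v)`. Some positive power of `a / ‖a‖` is near `1`, so a later iterate regains any strict
alternation of `Re (z v)`, which makes `Re (z a v)` sign definite. A suitable `z` makes its first
entry vanish. -/
lemma complex_eigenvalue_im {n : ℕ} {M : Matrix (Fin n) (Fin n) ℝ} (hM : VariationDiminishing M)
    {a : ℂ} {v : Fin n → ℂ} (hv : v ≠ 0) (h : M.map (algebraMap ℝ ℂ) *ᵥ v = a • v) :
    a.im = 0 := by
  obtain _ | n := n
  · exact absurd (Subsingleton.elim _ _) hv
  by_cases ha : a = 0
  · simp [ha]
  have hcoord : ∀ i, ∑ j, (M i j : ℂ) * v j = a * v i := fun i => by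
    simpa [Matrix.mulVec, dotProduct] using congrFun h i
  have hre : ∀ z : ℂ, M *ᵥ (fun j => (z * v j).re) = fun j => (z * a * v j).re := fun z => by
    ext i
    rw [mul_assoc, ← hcoord, Finset.mul_sum, Complex.re_sum]
    simp only [Matrix.mulVec, dotProduct]
    refine Finset.sum_congr rfl fun j _ => ?_
    rw [mul_left_comm, Complex.re_ofReal_mul]
  by_contra him
  have hne : ∀ z : ℂ, z ≠ 0 → (fun j => (z * v j).re) ≠ 0 := by
    intro z hz h0
    apply him
    obtain ⟨j, hj⟩ := Function.ne_iff.1 hv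
    have hj' : z * v j ≠ 0 := mul_ne_zero hz hj
    have h0' : ∀ j, (z * v j).re = 0 := fun j => congrFun h0 j
    have h1 : (z * a * v j).re = 0 := by
      have := congrFun (hre z) j
      rw [h0, Matrix.mulVec_zero] at this
      exact this.symm
    have h2 : (a * (z * v j)).re = 0 := by rw [← h1]; ring_nf
    rw [Complex.mul_re, h0' j, mul_zero, zero_sub, neg_eq_zero] at h2
    refine (mul_eq_zero.1 h2).resolve_right fun h3 => hj' (Complex.ext (h0' j) h3)
  have hdef : ∀ z : ℂ, z ≠ 0 → SignDefinite (fun j => (z * a * v j).re) := by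
    intro z hz ε hε k hk
    rw [← hre z] at hk
    have h1 := hM _ (hne z hz) ε hε k hk
    have hcont : Continuous fun w : ℂ => fun j => (z * w * v j).re := by fun_prop
    have hnhds : {w : ℂ | StrongAlt ε (fun j => (z * w * v j).re) k} ∈ 𝓝 (1 : ℂ) :=
      ((isOpen_strongAlt ε k).preimage hcont).mem_nhds (by simpa using h1)
    obtain ⟨m, hm⟩ := exists_pow_mem_of_norm_eq_one (u := a / ‖a‖) (by simp [ha]) hnhds
    have hpow : ∀ (m : ℕ) (z : ℂ), (M ^ m) *ᵥ (fun j => (z * v j).re) =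
        fun j => (z * a ^ m * v j).re := by
      intro m
      induction m with
      | zero => simp
      | succ m ih =>
        intro z
        rw [_root_.pow_succ, ← Matrix.mulVec_mulVec, hre, ih]
        ext j
        ring_nf
    refine hM.strongAlt_of_pow m ?_
    rw [hpow]
    obtain ⟨r, hr, hm⟩ := hm
    refine ⟨r, hr, fun i => ?_⟩
    have hpos : 0 < ‖a‖ ^ (m + 1) := by positivity
    have := mul_pos hpos (hm i)
    have heq : z * a * a ^ m * v (r i) =
        ((‖a‖ ^ (m + 1) : ℝ) : ℂ) * (z * (a / ‖a‖) ^ (m + 1) * v (r i)) := by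
      have : (‖a‖ : ℂ) ≠ 0 := by simpa using ha
      rw [div_pow]
      push_cast
      field_simp
      ring
    have hgoal : 0 < ε * (-1) ^ (i : ℕ) * (z * a * a ^ m * v (r i)).re := by
      rw [heq, Complex.re_ofReal_mul]
      linarith
    exact hgoal
  by_cases hv0 : v 0 = 0
  · exact (hdef 1 one_ne_zero).apply_zero_ne (by simp [hv0])
  · refine (hdef (Complex.I * (a * v 0)⁻¹) ?_).apply_zero_ne ?_
    · simp [ha, hv0]
    · have : Complex.I * (a * v 0)⁻¹ * a * v 0 = Complex.I := by field_simp
      change (Complex.I * (a * v 0)⁻¹ * a * v 0).re = 0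
      rw [this, Complex.I_re]

variable {n : ℕ} {M : Matrix (Fin n) (Fin n) ℝ}

/-- The combination with vanishing first entry would otherwise be an eigenvector, hence sign
definite. -/
lemma eigenvectors_parallel (hM : VariationDiminishing M) {x y : Fin n → ℝ} {a : ℝ}
    (hx0 : x ≠ 0) (hx : M *ᵥ x = a • x) (hy : M *ᵥ y = a • y) : ∃ c : ℝ, c • x = y := by
  obtain _ | n := n
  · exact ⟨0, Subsingleton.elim _ _⟩
  have ha := hM.eigenvalue_pos hx0 hx
  have h0 := (hM.signDefinite_of_eigenvector hx0 ha hx).apply_zero_ne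
  refine ⟨y 0 / x 0, ?_⟩
  by_contra hne
  have hw : (y 0 / x 0) • x - y ≠ 0 := sub_ne_zero.2 hne
  have hMw : M *ᵥ ((y 0 / x 0) • x - y) = a • ((y 0 / x 0) • x - y) := by
    rw [Matrix.mulVec_sub, Matrix.mulVec_smul, hx, hy, smul_sub, smul_comm]
  apply (hM.signDefinite_of_eigenvector hw ha hMw).apply_zero_ne
  simp [h0]

/-- Normalised forward iterates of `x` tend to `y`, backward ones to `-y`. A maximal alternation of
`x` thus passes to `-y`, becomes strict there because `y` is an eigenvector, and returns to `x` with
the opposite sign, so a longer one exists. -/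
lemma no_jordan (hM : VariationDiminishing M) {x y : Fin n → ℝ} {a : ℝ}
    (hx : M *ᵥ x = a • x + y) (hy : M *ᵥ y = a • y) : y = 0 := by
  by_contra hy0
  have ha := hM.eigenvalue_pos hy0 hy
  have hx0 : x ≠ 0 := by
    rintro rfl
    simp at hx
    exact hy0 hx.symm
  have hypow : ∀ m : ℕ, (M ^ m) *ᵥ y = a ^ m • y := by
    intro m
    induction m with
    | zero => simp
    | succ m ih => rw [_root_.pow_succ, ← Matrix.mulVec_mulVec, hy, Matrix.mulVec_smul, ih,
        smul_smul, _root_.pow_succ, mul_comm]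
  have hxpow : ∀ m : ℕ, (M ^ m) *ᵥ x = a ^ m • x + (m * a ^ m * a⁻¹) • y := by
    intro m
    induction m with
    | zero => simp
    | succ m ih =>
      rw [_root_.pow_succ, ← Matrix.mulVec_mulVec, hx, Matrix.mulVec_add, Matrix.mulVec_smul, ih,
        hypow]
      ext i
      simp only [Pi.add_apply, Pi.smul_apply, smul_eq_mul]
      push_cast
      field_simp
      ring
  have hlim0 : Tendsto (fun m : ℕ => ((m : ℝ) + 1)⁻¹) atTop (𝓝 0) := by
    simpa using tendsto_one_div_add_atTop_nhds_zero_nat (𝕜 := ℝ)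
  have hlim1 : Tendsto (fun m : ℕ => 1 - ((m : ℝ) + 1)⁻¹) atTop (𝓝 1) := by
    simpa using hlim0.const_sub 1
  have hm : ∀ m : ℕ, (m : ℝ) + 1 ≠ 0 := fun m => by positivity
  have hfwd : Tendsto (fun m : ℕ => (a * (a ^ m)⁻¹ * ((m : ℝ) + 1)⁻¹) • ((M ^ m) *ᵥ x)) atTop
      (𝓝 y) := by
    have h1 : Tendsto (fun m : ℕ => (a * ((m : ℝ) + 1)⁻¹) • x + (1 - ((m : ℝ) + 1)⁻¹) • y) atTop
        (𝓝 y) := by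
      simpa using ((hlim0.const_mul a).smul_const x).add (hlim1.smul_const y)
    refine h1.congr fun m => ?_
    rw [hxpow]
    ext i
    simp only [Pi.add_apply, Pi.smul_apply, smul_eq_mul]
    have := hm m
    field_simp
    ring
  set u : ℕ → Fin n → ℝ := fun m => (a ^ m)⁻¹ • x - (m * (a ^ m)⁻¹ * a⁻¹) • y
  have hu : ∀ m, (M ^ m) *ᵥ u m = x := fun m => by
    simp only [u]
    rw [Matrix.mulVec_sub, Matrix.mulVec_smul, Matrix.mulVec_smul, hypow, hxpow]
    ext i
    simp only [Pi.add_apply, Pi.sub_apply, Pi.smul_apply, smul_eq_mul]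
    field_simp
    ring
  have hbwd : Tendsto (fun m : ℕ => (a * a ^ m * ((m : ℝ) + 1)⁻¹) • u m) atTop (𝓝 (-y)) := by
    have h1 : Tendsto (fun m : ℕ => (a * ((m : ℝ) + 1)⁻¹) • x - (1 - ((m : ℝ) + 1)⁻¹) • y) atTop
        (𝓝 (-y)) := by
      simpa using ((hlim0.const_mul a).smul_const x).sub (hlim1.smul_const y)
    refine h1.congr fun m => ?_
    ext i
    simp only [u, Pi.sub_apply, Pi.smul_apply, smul_eq_mul]
    have := hm m
    field_simp
    ring
  obtain ⟨p, ⟨ε, hε⟩, hmax, -⟩ := exists_max_strongAlt x hx0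
  have h1 : WeakAlt ε (-y) p :=
    hM.weakAlt_of_tendsto_pow hx0 (fun m => by positivity) hu hbwd hε.ne_zero hε.weakAlt
  have h2 : WeakAlt (-ε) y p := by
    simpa using WeakAlt.of_smul (c := -1) (by simpa using h1)
  have h3 := hM.signDefinite_of_eigenvector hy0 ha hy _ (neg_ne_zero.2 hε.ne_zero) _ h2
  have h4 : StrongAlt (-ε) x p :=
    hM.strongAlt_of_tendsto_pow (fun m => by positivity) hfwd h3
  obtain ⟨η, hη⟩ := hε.succ_of_opposite h4 (by
    have := hε.ne_zero
    have : 0 < ε ^ 2 := by positivity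
    linarith)
  exact absurd (hmax _ _ hη) (by omega)

end VariationDiminishing

namespace VariationDiminishing

variable {n : ℕ} {M : Matrix (Fin n) (Fin n) ℝ}

/-- The multiplicity is the dimension of the generalized eigenspace, which `no_jordan` reduces to
the eigenspace and `eigenvectors_parallel` to a line. -/
lemma rootMultiplicity_charpoly_le (hM : VariationDiminishing M) (a : ℝ) :
    M.charpoly.rootMultiplicity a ≤ 1 := by
  set f : Module.End ℝ (Fin n → ℝ) := M.toLin'
  rw [← Matrix.charpoly_toLin', ← LinearMap.finrank_maxGenEigenspace_eq]
  have happ : ∀ x, (f - a • (1 : Module.End ℝ (Fin n → ℝ))) x = M *ᵥ x - a • x := fun x => by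
    simp [f, Matrix.toLin'_apply]
  have hsq : ∀ x, (f - a • (1 : Module.End ℝ (Fin n → ℝ)))
      ((f - a • (1 : Module.End ℝ (Fin n → ℝ))) x) = 0 →
      (f - a • (1 : Module.End ℝ (Fin n → ℝ))) x = 0 := by
    intro x hx
    rw [happ] at hx
    refine hM.no_jordan (x := x) (a := a) ?_ (sub_eq_zero.1 hx)
    rw [happ]
    abel
  have heig : ∀ x ∈ f.maxGenEigenspace a, M *ᵥ x = a • x := by
    intro x hx
    rw [Module.End.mem_maxGenEigenspace] at hx
    obtain ⟨k, hk⟩ := hx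
    rw [← sub_eq_zero, ← happ]
    induction k with
    | zero => simp only [pow_zero, Module.End.one_apply] at hk; rw [hk, map_zero]
    | succ k ih =>
      obtain _ | k := k
      · simpa using hk
      · apply ih
        rw [_root_.pow_succ', _root_.pow_succ'] at hk
        rw [_root_.pow_succ']
        exact hsq _ hk
  by_cases h0 : ∃ x : f.maxGenEigenspace a, x ≠ 0
  · obtain ⟨x, hx⟩ := h0
    refine finrank_le_one x fun y => ?_
    obtain ⟨c, hc⟩ := hM.eigenvectors_parallel (by simpa using hx) (heig x x.2) (heig y y.2)
    exact ⟨c, Subtype.ext hc⟩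
  · push Not at h0
    have : Subsingleton (f.maxGenEigenspace a) := ⟨fun x y => by rw [h0 x, h0 y]⟩
    rw [Module.finrank_zero_of_subsingleton]
    exact zero_le_one

lemma splits_charpoly (hM : VariationDiminishing M) : M.charpoly.Splits := by
  refine Polynomial.Splits.of_splits_map (algebraMap ℝ ℂ) (IsAlgClosed.splits _) fun a ha => ?_
  have hroot := Polynomial.isRoot_of_mem_roots ha
  rw [← Matrix.charpoly_map, Polynomial.IsRoot.def, Matrix.eval_charpoly,
    ← Matrix.exists_mulVec_eq_zero_iff] at hroot
  obtain ⟨v, hv, h⟩ := hroot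
  rw [Matrix.sub_mulVec, sub_eq_zero] at h
  have him := hM.complex_eigenvalue_im hv (a := a) (h.symm.trans (by
    simp [← Matrix.smul_one_eq_diagonal, Matrix.smul_mulVec]))
  exact ⟨a.re, Complex.ext (by simp) (by simp [him])⟩

/-- The eigenvalues are positive and simple. -/
theorem exists_eigenvalues (hM : VariationDiminishing M) :
    ∃ α : Fin n → ℝ, StrictAnti α ∧ (∀ k, 0 < α k) ∧
      M.charpoly = ∏ k, (Polynomial.X - Polynomial.C (α k)) := by
  have hnodup : M.charpoly.roots.Nodup := by
    rw [Multiset.nodup_iff_count_le_one]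
    intro a
    rw [Polynomial.count_roots]
    exact hM.rootMultiplicity_charpoly_le a
  have hs := hM.splits_charpoly
  set s : Finset ℝ := M.charpoly.roots.toFinset
  have hval : s.val = M.charpoly.roots := by
    simp [s, hnodup.dedup]
  have hcard : s.card = n := by
    rw [Finset.card_def, hval, ← hs.natDegree_eq_card_roots, Matrix.charpoly_natDegree_eq_dim,
      Fintype.card_fin]
  -- The enumeration is increasing, hence the reversal.
  refine ⟨fun k => s.orderEmbOfFin hcard k.rev, fun i j hij => ?_, fun k => ?_, ?_⟩
  · exact (s.orderEmbOfFin hcard).strictMono (Fin.rev_lt_rev.2 hij)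
  · have hmem := s.orderEmbOfFin_mem hcard k.rev
    rw [Multiset.mem_toFinset] at hmem
    have hroot := Polynomial.isRoot_of_mem_roots hmem
    rw [Polynomial.IsRoot.def, Matrix.eval_charpoly, ← Matrix.exists_mulVec_eq_zero_iff] at hroot
    obtain ⟨v, hv, h⟩ := hroot
    rw [Matrix.sub_mulVec, sub_eq_zero] at h
    refine hM.eigenvalue_pos hv (h.symm.trans ?_)
    simp [← Matrix.smul_one_eq_diagonal, Matrix.smul_mulVec]
  · have h1 : M.charpoly = ∏ a ∈ s, (Polynomial.X - Polynomial.C a) := by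
      rw [hs.eq_prod_roots_of_monic (Matrix.charpoly_monic M), ← hval]
      rfl
    rw [h1]
    conv_lhs => rw [← Finset.map_orderEmbOfFin_univ s hcard, Finset.prod_map]
    exact (Equiv.prod_comp Fin.revPerm _).symm

/-! ### Sign changes of combinations of eigenvectors. -/

section Eigenvectors

variable {α : Fin n → ℝ} {p : Fin n → Fin n → ℝ}

lemma pow_mulVec_sum (hp : ∀ k, M *ᵥ p k = α k • p k) (c : Fin n → ℝ) (m : ℕ) :
    (M ^ m) *ᵥ (∑ k, c k • p k) = ∑ k, (c k * α k ^ m) • p k := by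
  induction m with
  | zero => simp
  | succ m ih =>
    rw [_root_.pow_succ', ← Matrix.mulVec_mulVec, ih, Matrix.mulVec_sum]
    refine Finset.sum_congr rfl fun k _ => ?_
    rw [Matrix.mulVec_smul, hp, smul_smul]
    ring_nf

lemma tendsto_forward (hα : StrictAnti α) (hpos : ∀ k, 0 < α k)
    (hp : ∀ k, M *ᵥ p k = α k • p k) {c : Fin n → ℝ} {i : Fin n} (hc : ∀ k < i, c k = 0) :
    Tendsto (fun m : ℕ => (α i ^ m)⁻¹ • ((M ^ m) *ᵥ (∑ k, c k • p k))) atTop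
      (𝓝 (c i • p i)) := by
  have h1 : Tendsto (fun m : ℕ => ∑ k, (c k * (α k / α i) ^ m) • p k) atTop
      (𝓝 (∑ k, if k = i then c k • p k else 0)) := by
    refine tendsto_finsetSum _ fun k _ => ?_
    split_ifs with hk
    · subst hk
      simp [(hpos k).ne']
    · rcases lt_or_gt_of_ne hk with h | h
      · simp [hc k h]
      · have h2 : Tendsto (fun m : ℕ => (α k / α i) ^ m) atTop (𝓝 0) :=
          tendsto_pow_atTop_nhds_zero_of_lt_one (div_pos (hpos k) (hpos i)).le
            ((div_lt_one (hpos i)).2 (hα h))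
        simpa using (h2.const_mul (c k)).smul_const (p k)
  rw [Finset.sum_ite_eq' Finset.univ i, if_pos (Finset.mem_univ i)] at h1
  refine h1.congr fun m => ?_
  rw [pow_mulVec_sum hp, Finset.smul_sum]
  refine Finset.sum_congr rfl fun k _ => ?_
  rw [smul_smul, div_pow]
  ring_nf

lemma strongAlt_sum (hM : VariationDiminishing M) (hα : StrictAnti α) (hpos : ∀ k, 0 < α k)
    (hp : ∀ k, M *ᵥ p k = α k • p k) {c : Fin n → ℝ} {i : Fin n} (hci : c i ≠ 0)
    (hc : ∀ k < i, c k = 0) {ε : ℝ} {q : ℕ} (h : StrongAlt ε (p i) q) :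
    ∃ δ, StrongAlt δ (∑ k, c k • p k) q := by
  refine ⟨ε * c i, hM.strongAlt_of_tendsto_pow (fun m => inv_pos.2 (pow_pos (hpos i) m))
    (tendsto_forward hα hpos hp hc) ?_⟩
  obtain ⟨r, hr, h⟩ := h
  refine ⟨r, hr, fun l => ?_⟩
  have h2 : 0 < c i ^ 2 := by positivity
  have := mul_pos h2 (h l)
  simp only [Pi.smul_apply, smul_eq_mul]
  linarith

lemma weakAlt_of_weakAlt_sum (hM : VariationDiminishing M) (hα : StrictAnti α)
    (hpos : ∀ k, 0 < α k) (hp : ∀ k, M *ᵥ p k = α k • p k) {c : Fin n → ℝ} {j : Fin n}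
    (hc : ∀ k, j < k → c k = 0) (h0 : ∑ k, c k • p k ≠ 0) {ε : ℝ} (hε : ε ≠ 0)
    {q : ℕ} (h : WeakAlt ε (∑ k, c k • p k) q) : WeakAlt (ε * c j) (p j) q := by
  have hu : ∀ m : ℕ, (M ^ m) *ᵥ (∑ k, (c k * (α k ^ m)⁻¹) • p k) = ∑ k, c k • p k := by
    intro m
    rw [pow_mulVec_sum hp]
    refine Finset.sum_congr rfl fun k _ => ?_
    rw [inv_mul_cancel_right₀ (pow_pos (hpos k) m).ne']
  have hlim : Tendsto (fun m : ℕ => α j ^ m • ∑ k, (c k * (α k ^ m)⁻¹) • p k) atTop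
      (𝓝 (c j • p j)) := by
    have h1 : Tendsto (fun m : ℕ => ∑ k, (c k * (α j / α k) ^ m) • p k) atTop
        (𝓝 (∑ k, if k = j then c k • p k else 0)) := by
      refine tendsto_finsetSum _ fun k _ => ?_
      split_ifs with hk
      · subst hk
        simp [(hpos k).ne']
      · rcases lt_or_gt_of_ne hk with h | h
        · have h2 : Tendsto (fun m : ℕ => (α j / α k) ^ m) atTop (𝓝 0) :=
            tendsto_pow_atTop_nhds_zero_of_lt_one (div_pos (hpos j) (hpos k)).le
              ((div_lt_one (hpos k)).2 (hα h))
          simpa using (h2.const_mul (c k)).smul_const (p k)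
        · simp [hc k h]
    rw [Finset.sum_ite_eq' Finset.univ j, if_pos (Finset.mem_univ j)] at h1
    refine h1.congr fun m => ?_
    rw [Finset.smul_sum]
    refine Finset.sum_congr rfl fun k _ => ?_
    rw [smul_smul, div_pow]
    ring_nf
  exact (hM.weakAlt_of_tendsto_pow h0 (fun m => pow_pos (hpos j) m) hu hlim hε h).of_smul

/-- The `k`-th eigenvector has exactly `k` sign changes (counting from `k = 0`). -/
theorem eigenvector_sign_changes (hM : VariationDiminishing M) (hα : StrictAnti α)
    (hpos : ∀ k, 0 < α k) (hp0 : ∀ k, p k ≠ 0) (hp : ∀ k, M *ᵥ p k = α k • p k) (k : Fin n) :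
    (∃ ε, StrongAlt ε (p k) k) ∧ ∀ ε q, StrongAlt ε (p k) q → q ≤ k := by
  choose s hs hmax _ using fun k => exists_max_strongAlt (p k) (hp0 k)
  have hdef : ∀ k, SignDefinite (p k) := fun k =>
    hM.signDefinite_of_eigenvector (hp0 k) (hpos k) (hp k)
  obtain _ | n := n
  · exact k.elim0
  have hmono : StrictMono s := by
    intro i j hij
    by_contra hle
    push Not at hle
    have hi := (hdef i).apply_zero_ne
    have hj := (hdef j).apply_zero_ne
    -- This combination has first entry zero, which lengthens its weak alternation by one; so `p j`
    -- gets at least one change more than `p i`.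
    set c : Fin (n + 1) → ℝ := fun k => if k = i then p j 0 else if k = j then -p i 0 else 0
    have hsum : ∑ k, c k • p k = p j 0 • p i - p i 0 • p j := by
      rw [Finset.sum_eq_add_of_mem i j (Finset.mem_univ _) (Finset.mem_univ _) hij.ne]
      · simp [c, hij.ne', sub_eq_add_neg]
      · rintro k - ⟨h1, h2⟩
        simp [c, h1, h2]
    obtain ⟨ε, hε⟩ := hs i
    obtain ⟨δ, hδ⟩ := hM.strongAlt_sum hα hpos hp (c := c) (i := i) (by simpa [c] using hj)
      (fun k hk => by simp [c, hk.ne, (hk.trans hij).ne]) hε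
    have h1 := hδ.weakAlt_succ_of_first_eq_zero (by rw [hsum]; simp [mul_comm])
    have h2 := hM.weakAlt_of_weakAlt_sum hα hpos hp (c := c) (j := j)
      (fun k hk => by simp [c, hk.ne', (hij.trans hk).ne']) hδ.vec_ne_zero
      (neg_ne_zero.2 hδ.ne_zero) h1
    have hcj : c j ≠ 0 := by simpa [c, hij.ne'] using hi
    have h3 := hmax j _ _ (hdef j _ (mul_ne_zero (neg_ne_zero.2 hδ.ne_zero) hcj) _ h2)
    omega
  have hlt : ∀ k, s k < n + 1 := fun k => by
    obtain ⟨ε, hε⟩ := hs k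
    exact hε.weakAlt.lt
  -- A strictly increasing self-map of a finite chain is the identity.
  have hid : (fun k => (⟨s k, hlt k⟩ : Fin (n + 1))) = id := by
    have hm : StrictMono fun k => (⟨s k, hlt k⟩ : Fin (n + 1)) := fun i j hij => hmono hij
    rw [← StrictMono.range_inj hm strictMono_id,
      (Finite.surjective_of_injective hm.injective).range_eq, range_id]
  have hsk : s k = k := congrArg Fin.val (congrFun hid k)
  rw [← hsk]
  exact ⟨hs k, hmax k⟩

theorem sum_sign_changes (hM : VariationDiminishing M) (hα : StrictAnti α)
    (hpos : ∀ k, 0 < α k) (hp0 : ∀ k, p k ≠ 0) (hp : ∀ k, M *ᵥ p k = α k • p k)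
    {c : Fin n → ℝ} {i j : Fin n} (hci : c i ≠ 0) (hlow : ∀ k < i, c k = 0)
    (hhigh : ∀ k, j < k → c k = 0) :
    (∃ ε, StrongAlt ε (∑ k, c k • p k) i) ∧
      ∀ ε, ε ≠ 0 → ∀ q, WeakAlt ε (∑ k, c k • p k) q → q ≤ j := by
  obtain ⟨ε, hε⟩ := (hM.eigenvector_sign_changes hα hpos hp0 hp i).1
  obtain ⟨δ, hδ⟩ := hM.strongAlt_sum hα hpos hp hci hlow hε
  refine ⟨⟨δ, hδ⟩, fun η hη q hq => ?_⟩
  -- `c j` may vanish, so the backward limit uses the last nonzero coefficient.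
  obtain ⟨l, hl, hlmax⟩ := (Finset.univ.filter fun k => c k ≠ 0).exists_max_image id
    ⟨i, by simpa using hci⟩
  simp only [Finset.mem_filter, Finset.mem_univ, true_and, id] at hl hlmax
  have hlj : l ≤ j := not_lt.1 fun h => hl (hhigh l h)
  have h1 := hM.weakAlt_of_weakAlt_sum hα hpos hp (c := c) (j := l)
    (fun k hk => by_contra fun h => absurd (hlmax k h) (not_le.2 hk)) hδ.vec_ne_zero hη hq
  have h2 := (hM.eigenvector_sign_changes hα hpos hp0 hp l).2 _ _
    (hM.signDefinite_of_eigenvector (hp0 l) (hpos l) (hp l) _ (mul_ne_zero hη hl) _ h1)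
  exact h2.trans hlj

end Eigenvectors

end VariationDiminishing

/-! ### Exceptional times and the main theorem. -/

lemma WeakAlt.succ_of_opposite {n : ℕ} {y : Fin n → ℝ} {ε δ : ℝ} {k : ℕ}
    (h : WeakAlt ε y k) (h' : StrongAlt δ y k) (hεδ : ε * δ < 0) :
    ∃ η, η ≠ 0 ∧ WeakAlt η y (k + 1) := by
  have key : ∀ {ε δ : ℝ} (r s : Fin (k + 1) → Fin n), StrictMono s →
      (∀ i : Fin (k + 1), 0 ≤ ε * (-1) ^ (i : ℕ) * y (r i)) →
      (∀ i : Fin (k + 1), 0 ≤ δ * (-1) ^ (i : ℕ) * y (s i)) → ε * δ < 0 → r 0 < s 0 →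
      WeakAlt ε y (k + 1) := by
    intro ε δ r s hs h1 h2 hεδ h0
    refine ⟨Fin.cons (r 0) s, ?_, fun i : Fin (k + 2) => ?_⟩
    · rw [Fin.strictMono_iff_lt_succ]
      intro i
      cases i using Fin.cases with
      | zero => simpa using h0
      | succ i =>
        rw [← Fin.succ_castSucc, Fin.cons_succ, Fin.cons_succ]
        exact hs Fin.castSucc_lt_succ
    · cases i using Fin.cases with
      | zero => simpa using h1 0
      | succ i =>
        have h3 := mul_nonneg_of_nonpos_of_nonpos hεδ.le (neg_nonpos.2 (h2 i))
        have h4 : 0 < δ ^ 2 := by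
          have : δ ≠ 0 := by rintro rfl; simp at hεδ
          positivity
        simp only [Fin.cons_succ, Fin.val_succ, pow_succ]
        refine nonneg_of_mul_nonneg_right (a := δ ^ 2) ?_ h4
        nlinarith
  obtain ⟨r, hr, h1⟩ := h
  obtain ⟨s, hs, h2⟩ := h'
  rcases lt_trichotomy (r 0) (s 0) with h | h | h
  · exact ⟨ε, by rintro rfl; simp at hεδ, key r s hs h1 (fun i => (h2 i).le) hεδ h⟩
  · exfalso
    have h3 := h1 0
    have h4 := h2 0
    rw [h] at h3
    simp only [Fin.val_zero, pow_zero, mul_one] at h3 h4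
    have h5 := mul_nonneg h3 h4.le
    have h6 : 0 < y (s 0) ^ 2 := by
      have : y (s 0) ≠ 0 := fun h => by simp [h] at h4
      positivity
    nlinarith
  · exact ⟨δ, by rintro rfl; simp at hεδ,
      key s r hr (fun i => (h2 i).le) h1 (by linarith) h⟩

lemma exists_weakAlt_succ_of_not_signDefinite {n : ℕ} {y : Fin n → ℝ} (hy : ¬ SignDefinite y)
    {δ : ℝ} {a : ℕ} (h : StrongAlt δ y a) : ∃ η, η ≠ 0 ∧ WeakAlt η y (a + 1) := by
  unfold SignDefinite at hy
  push Not at hy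
  obtain ⟨ε, hε, k, hk, hnk⟩ := hy
  rcases lt_trichotomy k a with hka | rfl | hka
  · exact absurd (h.of_lt hka hε) hnk
  · rcases lt_or_gt_of_ne (mul_ne_zero hε h.ne_zero) with h0 | h0
    · exact hk.succ_of_opposite h h0
    · exact absurd (h.sign_congr (by linarith)) hnk
  · exact ⟨ε, hε, hk.mono hka⟩

/-- At a bad time `t` a weak alternation of length `a t + 1` exists and becomes strict at every
earlier time. So `a` is strictly decreasing on bad times, with values in `[i, j)`. -/
lemma exists_finset_sign_changes {n : ℕ} {z : ℝ → Fin n → ℝ} {i j : ℕ}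
    (hvd : ∀ s t, 0 ≤ s → s < t → ∀ ε q, ε ≠ 0 → WeakAlt ε (z t) q → StrongAlt ε (z s) q)
    (hlow : ∀ t, 0 ≤ t → ∃ ε, StrongAlt ε (z t) i)
    (hhigh : ∀ t, 0 ≤ t → ∀ ε q, ε ≠ 0 → WeakAlt ε (z t) q → q ≤ j) :
    ∃ S : Finset ℝ, S.card ≤ j - i ∧ ∀ t, 0 ≤ t → t ∉ S →
      z t ∈ signSet n ∧ i ≤ signVariations (z t) ∧ signVariations (z t) ≤ j := by
  have hex : ∀ t, ∃ a, 0 ≤ t → (∃ ε, StrongAlt ε (z t) a) ∧ ∀ ε q, StrongAlt ε (z t) q → q ≤ a := by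
    intro t
    by_cases ht : 0 ≤ t
    · obtain ⟨ε, hε⟩ := hlow t ht
      obtain ⟨a, h1, h2, -⟩ := exists_max_strongAlt (z t) hε.vec_ne_zero
      exact ⟨a, fun _ => ⟨h1, h2⟩⟩
    · exact ⟨0, fun h => absurd h ht⟩
  choose a ha using hex
  have hia : ∀ t, 0 ≤ t → i ≤ a t := fun t ht => by
    obtain ⟨ε, hε⟩ := hlow t ht
    exact (ha t ht).2 ε i hε
  have haj : ∀ t, 0 ≤ t → a t ≤ j := fun t ht => by
    obtain ⟨ε, hε⟩ := (ha t ht).1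
    exact hhigh t ht ε _ hε.ne_zero hε.weakAlt
  set B : Set ℝ := {t | 0 ≤ t ∧ ¬ SignDefinite (z t)}
  have hstep : ∀ t ∈ B, ∃ η, η ≠ 0 ∧ WeakAlt η (z t) (a t + 1) := fun t ht => by
    obtain ⟨ε, hε⟩ := (ha t ht.1).1
    exact exists_weakAlt_succ_of_not_signDefinite ht.2 hε
  have hanti : ∀ s ∈ B, ∀ t ∈ B, s < t → a t < a s := fun s hs t ht hst => by
    obtain ⟨η, hη, h⟩ := hstep t ht
    exact (ha s hs.1).2 η _ (hvd s t hs.1 hst η _ hη h)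
  have hmaps : MapsTo a B (Finset.Ico i j : Set ℕ) := fun t ht => by
    obtain ⟨η, hη, h⟩ := hstep t ht
    have h1 := hhigh t ht.1 η _ hη h
    have h2 := hia t ht.1
    simp only [Finset.coe_Ico, mem_Ico]
    omega
  have hinj : InjOn a B := fun s hs t ht hst => by
    rcases lt_trichotomy s t with h | h | h
    · exact absurd (hanti s hs t ht h) (by omega)
    · exact h
    · exact absurd (hanti t ht s hs h) (by omega)
  have hfin : B.Finite := Set.Finite.of_injOn hmaps hinj (Finset.finite_toSet _)
  refine ⟨hfin.toFinset, ?_, fun t ht htS => ?_⟩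
  · rw [← Nat.card_Ico i j]
    exact Finset.card_le_card_of_injOn a (by simpa using hmaps) (by simpa using hinj)
  · have hdef : SignDefinite (z t) := by
      by_contra h
      exact htS (by simpa using ⟨ht, h⟩)
    rw [hdef.signVariations_eq (ha t ht).1 (ha t ht).2]
    exact ⟨hdef.mem_signSet, hia t ht, haj t ht⟩

lemma IsTransitionMatrix.apply_nat_mul {n : ℕ} {A : ℝ → Matrix (Fin n) (Fin n) ℝ}
    {Φ : ℝ → ℝ → Matrix (Fin n) (Fin n) ℝ} (hA : IsLocallyEssBoundedMeasurable A)
    (hΦ : IsTransitionMatrix A Φ) {T : ℝ} (hT : 0 < T) (hper : ∀ t, A (t + T) = A t)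
    {z : ℝ → Fin n → ℝ} (hz : IsSolutionOn A (Ici 0) z) (N : ℕ) :
    z (N * T) = (Φ T 0 ^ N) *ᵥ z 0 := by
  have hshift : ∀ N : ℕ, Φ ((N + 1) * T) (N * T) = Φ T 0 := by
    intro N
    induction N with
    | zero => simp
    | succ N ih =>
      rw [← ih, ← hΦ.periodic hA hper (s := N * T) (t := (N + 1) * T) (by nlinarith)]
      push_cast
      ring_nf
  induction N with
  | zero => simp
  | succ N ih =>
    have h0 : 0 ≤ (N : ℝ) * T := by positivity
    rw [hΦ.eq_mulVec hA (s := N * T) (by push_cast; nlinarith) hz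
      (fun t ht => h0.trans ht.1), ih, pow_succ', ← Matrix.mulVec_mulVec]
    push_cast
    rw [hshift]

theorem mainTheorem6 (n : ℕ) (T : ℝ) (hT : 0 < T)
    (A : ℝ → Matrix (Fin n) (Fin n) ℝ) (hA : IsLocallyEssBoundedMeasurable A)
    (hper : ∀ t, A (t + T) = A t)
    (Φ : ℝ → ℝ → Matrix (Fin n) (Fin n) ℝ) (hΦ : IsTransitionMatrix A Φ)
    (hTP : IsTPDS Φ 0 T) :
    -- the monodromy matrix has eigenvalues `α 0 > α 1 > ... > α (n - 1) > 0`
    ∃ α : Fin n → ℝ, StrictAnti α ∧ (∀ k, 0 < α k) ∧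
      (Φ T 0).charpoly = ∏ k, (Polynomial.X - Polynomial.C (α k)) ∧
      -- for every choice of corresponding eigenvectors `p k`
      ∀ p : Fin n → Fin n → ℝ, (∀ k, p k ≠ 0 ∧ Φ T 0 *ᵥ p k = α k • p k) →
        ∀ (i j : Fin n) (c : Fin n → ℝ) (z : ℝ → Fin n → ℝ), i ≤ j → c i ≠ 0 →
          IsSolutionOn A (Ici 0) z → z 0 = ∑ k ∈ Finset.Icc i j, c k • p k →
          -- indices start at `0`, so `(i : ℕ)` and `(j : ℕ)` are the bounds `i - 1` and `j - 1`
          (∃ S : Finset ℝ, S.card ≤ (j : ℕ) - (i : ℕ) ∧ ∀ t, 0 ≤ t → t ∉ S →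
            z t ∈ signSet n ∧ (i : ℕ) ≤ signVariations (z t) ∧ signVariations (z t) ≤ (j : ℕ)) ∧
          (∀ᶠ t in atTop, z t ∈ signSet n ∧ signVariations (z t) = (i : ℕ)) ∧
          (z 0 = c i • p i → ∀ t, 0 ≤ t → z t ∈ signSet n ∧ signVariations (z t) = (i : ℕ)) := by
  have hVD : ∀ s t, 0 ≤ s → s < t → VariationDiminishing (Φ t s) := fun s t hs hst =>
    hTP.variationDiminishing hA hΦ hT hper hs hst
  have hM := hVD 0 T le_rfl hT
  obtain ⟨α, hα, hpos, hchar⟩ := hM.exists_eigenvalues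
  refine ⟨α, hα, hpos, hchar, fun p hp i j c z hij hci hz hz0 => ?_⟩
  have hp0 : ∀ k, p k ≠ 0 := fun k => (hp k).1
  have hpe : ∀ k, Φ T 0 *ᵥ p k = α k • p k := fun k => (hp k).2
  have hflow : ∀ s t, 0 ≤ s → s < t → z t = Φ t s *ᵥ z s := fun s t hs hst =>
    hΦ.eq_mulVec hA hst.le hz fun u hu => hs.trans hu.1
  have hnat : ∀ N : ℕ, z (N * T) = (Φ T 0 ^ N) *ᵥ z 0 := hΦ.apply_nat_mul hA hT hper hz
  have hsum : ∀ j : Fin n, ∑ k ∈ Finset.Icc i j, c k • p k =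
      ∑ k, (if k ∈ Finset.Icc i j then c k else 0) • p k := fun j => by
    simp only [ite_smul, zero_smul, Finset.sum_ite_mem, Finset.univ_inter]
  have hcoef : ∀ j : Fin n, (∀ k < i, (if k ∈ Finset.Icc i j then c k else 0) = 0) ∧
      ∀ k, j < k → (if k ∈ Finset.Icc i j then c k else 0) = 0 := fun j =>
    ⟨fun k hk => by simp [not_le.2 hk], fun k hk => by simp [not_le.2 hk]⟩
  have hlow : ∀ t, 0 ≤ t → ∃ ε, StrongAlt ε (z t) i := by
    intro t ht
    -- At a later multiple of `T` the solution is again such a combination, with lowest coefficient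
    -- nonzero; its alternations pull back to time `t`.
    obtain ⟨N, hN⟩ := exists_nat_gt (t / T)
    have htN : t < N * T := (div_lt_iff₀ hT).1 hN
    obtain ⟨ε, hε⟩ := (hM.sum_sign_changes hα hpos hp0 hpe (i := i) (j := j)
      (c := fun k => (if k ∈ Finset.Icc i j then c k else 0) * α k ^ N)
      (by simp [hij, hci, (hpos i).ne'])
      (fun k hk => by rw [(hcoef j).1 k hk, zero_mul])
      (fun k hk => by rw [(hcoef j).2 k hk, zero_mul])).1
    rw [← VariationDiminishing.pow_mulVec_sum hpe, ← hsum, ← hz0, ← hnat,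
      hflow t _ ht htN] at hε
    exact ⟨ε, (hVD t _ ht htN).strongAlt hε⟩
  have hne : ∀ t, 0 ≤ t → z t ≠ 0 := fun t ht => by
    obtain ⟨ε, hε⟩ := hlow t ht
    exact hε.vec_ne_zero
  have hvd : ∀ s t, 0 ≤ s → s < t → ∀ ε q, ε ≠ 0 → WeakAlt ε (z t) q → StrongAlt ε (z s) q := by
    intro s t hs hst ε q hε h
    rw [hflow s t hs hst] at h
    exact hVD s t hs hst _ (hne s hs) ε hε q h
  have hhigh : ∀ j : Fin n, i ≤ j → z 0 = ∑ k ∈ Finset.Icc i j, c k • p k →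
      ∀ t, 0 ≤ t → ∀ ε q, ε ≠ 0 → WeakAlt ε (z t) q → q ≤ j := by
    intro j hij hz0 t ht ε q hε h
    have h0 : WeakAlt ε (z 0) q := by
      rcases ht.eq_or_lt with rfl | ht
      · exact h
      · exact (hvd 0 t le_rfl ht ε q hε h).weakAlt
    rw [hz0, hsum] at h0
    exact (hM.sum_sign_changes hα hpos hp0 hpe (by simpa [hij] using hci) (hcoef j).1
      (hcoef j).2).2 ε hε q h0
  refine ⟨exists_finset_sign_changes hvd hlow (hhigh j hij hz0), ?_, fun hzi t ht => ?_⟩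
  · have hlim := VariationDiminishing.tendsto_forward hα hpos hpe (hcoef j).1
    rw [← hsum, ← hz0, if_pos (Finset.mem_Icc.2 ⟨le_rfl, hij⟩)] at hlim
    -- The rescaled iterates tend to `c i • p i`, which has no weak alternation of length `i + 1`,
    -- and this is an open condition. Only the sign of `ε` matters, so `1` and `-1` suffice below.
    have hnot : ∀ ε : ℝ, ε ≠ 0 → ∀ᶠ N : ℕ in atTop, ¬ WeakAlt ε (z (N * T)) (i + 1) := by
      intro ε hε
      have hci' : ¬ WeakAlt ε (c i • p i) (i + 1) := fun h => by
        have h1 := hM.signDefinite_of_eigenvector (hp0 i) (hpos i) (hpe i) _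
          (mul_ne_zero hε hci) _ h.of_smul
        have := (hM.eigenvector_sign_changes hα hpos hp0 hpe i).2 _ _ h1
        omega
      filter_upwards [hlim.eventually ((isClosed_weakAlt ε (i + 1)).isOpen_compl.mem_nhds hci')]
        with N hN h
      apply hN
      rw [hnat] at h
      obtain ⟨r, hr, h⟩ := h
      refine ⟨r, hr, fun l => ?_⟩
      have := mul_nonneg (inv_nonneg.2 (pow_pos (hpos i) N).le) (h l)
      simp only [Pi.smul_apply, smul_eq_mul]
      linarith
    obtain ⟨N, hN1, hN2⟩ := ((hnot 1 one_ne_zero).and (hnot (-1) (by norm_num))).exists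
    have hN0 : 0 ≤ (N : ℝ) * T := by positivity
    filter_upwards [eventually_gt_atTop ((N : ℝ) * T)] with t ht
    have ht0 : 0 ≤ t := hN0.trans ht.le
    have hle : ∀ ε q, ε ≠ 0 → WeakAlt ε (z t) q → q ≤ i := by
      intro ε q hε h
      by_contra hq
      have h1 := ((hvd _ t hN0 ht ε q hε h).mono (show (i : ℕ) + 1 ≤ q by omega)).weakAlt
      rcases lt_or_gt_of_ne hε with h2 | h2
      · exact hN2 (h1.sign_congr (by linarith))
      · exact hN1 (h1.sign_congr (by linarith))
    obtain ⟨ε, hε⟩ := hlow t ht0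
    have hdef : SignDefinite (z t) := by
      by_contra h
      obtain ⟨η, hη, h1⟩ := exists_weakAlt_succ_of_not_signDefinite h hε
      exact absurd (hle η _ hη h1) (by omega)
    exact ⟨hdef.mem_signSet, hdef.signVariations_eq ⟨ε, hε⟩
      fun δ q hq => hle δ q hq.ne_zero hq.weakAlt⟩
  -- With `j = i` no exceptional time is allowed.
  · obtain ⟨S, hS, h⟩ := exists_finset_sign_changes hvd hlow
      (hhigh i le_rfl (by rw [hzi, Finset.Icc_self, Finset.sum_singleton]))
    obtain rfl : S = ∅ := Finset.card_eq_zero.1 (by omega)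
    obtain ⟨h1, h2, h3⟩ := h t ht (Finset.notMem_empty t)
    exact ⟨h1, le_antisymm h3 h2⟩
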